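/- Let $(T,\mathcal A,\mu)$ be a complete $\sigma$-finite measure space, and let $X$ be a separable Banach space with separable dual $X^*$ (a separable Asplund space) whose norm is $C^1$ on $X\setminus\{0\}$. A normal integrand is an $\mathcal A\otimes\mathcal B(X)$-measurable function $h:T\times X\to[-\infty,+\infty]$ such that $h_t:=h(t,\cdot)$ is lower semicontinuous for every $t\in T$. For a function $\varphi:X\to[-\infty,+\infty]$ that is finite at $u$, the Fréchet subdifferential is $$\hat\partial\varphi(u)=\Big\{u^*\in X^*:\ \liminf_{h\to0,\,h\ne 0}\frac{\varphi(u+h)-\varphi(u)-\langle u^*,h\rangle}{\|h\|}\ge 0\Big\},$$ and $\hat\partial\varphi(u)=\emptyset$ if $|\varphi(u)|=+\infty$. Write $\hat\partial f(t,u):=\hat\partial f_t(u)$ and $$I_f(u):=\int_T f(t,u)^+\,d\mu(t)-\int_T f(t,u)^-\,d\mu(t)\in[-\infty,+\infty],\qquad \infty-\infty:=+\infty,$$ where $a^+=\max\{a,0\}$ and $a^-=\max\{-a,0\}$. **Theorem.** Let $f:T\times X\to[-\infty,+\infty]$ and $g:T\times X\to\mathbb R$ be normal integrands such that $f(t,u)\ge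 g(t,u)$ for all $t\in T$, $u\in X$, and $g_t$ is $C^1$ on $X$ for every $t\in T$. Assume that $g(\cdot,u_0)$ is integrable for some $u_0\in X$ and that $t\mapsto\sup_{u\in X}\|\nabla g_t(u)\|$ belongs to $L^1(T,\mathbb R)$. Let $x\in X$, $x^*\in\hat\partial I_f(x)$, and let $\rho$ be a $w^*$-continuous seminorm on $X^*$. Then there exist sequences $y_n\in X$, $x_n\in L^\infty(T,X)$ and $x_n^*\in L^1(T,X^*)$ such that (a) $x_n^*(t)\in\hat\partial f(t,x_n(t))$ for almost every $t\in T$, for every $n$; (b) $\|x-y_n\|\to0$ and $\|x-x_n(\cdot)\|_\infty\to0$; (c) $\displaystyle\int_T\|x_n^*(t)\|\,\|x_n(t)-y_n\|\,d\mu(t)\to0$; (d) $\displaystyle\int_T\langle x_n^*(t),x_n(t)-x\rangle\,d\mu(t)\to0$; (e) $\displaystyle\rho\Big(\int_T x_n^*(t)\,d\mu(t)-x^*\Big)\to0$ (Bochner integral); (f) $\displaystyle\int_T|f(t,x_n(t))-f(t,x)|\,d\mu(t)\to0$. -/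

import Mathlib

open MeasureTheory Filter Topology
open scoped ENNReal

noncomputable section

/-- The Fréchet (regular) subdifferential of `φ : X → [-∞, +∞]` at `x`. It is empty where `φ` is
not finite, and otherwise consists of the `x'` in the dual with
`liminf_{h → 0, h ≠ 0} (φ (x + h) - φ x - ⟨x', h⟩) / ‖h‖ ≥ 0`. -/
def frechetSubdifferential {X : Type*} [NormedAddCommGroup X] [NormedSpace ℝ X]
    (φ : X → EReal) (x : X) : Set (StrongDual ℝ X) :=
  {x' | φ x ≠ ⊤ ∧ φ x ≠ ⊥ ∧
    0 ≤ liminf (fun h : X => (φ (x + h) - φ x - ((x' h : ℝ) : EReal)) / ((‖h‖ : ℝ) : EReal))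
      (𝓝[≠] (0 : X))}

/-- A normal integrand: jointly measurable for the product of the given `σ`-algebra on `T` and the
Borel `σ`-algebra of `X`, and lower semicontinuous in the second variable. -/
structure IsNormalIntegrand {T X : Type*} [MeasurableSpace T] [TopologicalSpace X]
    [MeasurableSpace X] [BorelSpace X] (f : T → X → EReal) : Prop where
  measurable : Measurable (Function.uncurry f)
  lowerSemicontinuous : ∀ t, LowerSemicontinuous (f t)

/-- The extended-real integral `∫ φ⁺ - ∫ φ⁻`, with the convention `∞ - ∞ = +∞`. -/
def extendedIntegral {T : Type*} [MeasurableSpace T] (μ : Measure T) (φ : T → EReal) : EReal :=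
  open Classical in
  if ∫⁻ t, (φ t).toENNReal ∂μ = ∞ then ⊤
  else ((∫⁻ t, (φ t).toENNReal ∂μ : ℝ≥0∞) : EReal) - ((∫⁻ t, (-φ t).toENNReal ∂μ : ℝ≥0∞) : EReal)

/-- The integral functional `I_f : X → [-∞, +∞]`, `I_f u = ∫ f(t, u) dμ(t)`. -/
def integralFunctional {T X : Type*} [MeasurableSpace T] (μ : Measure T) (f : T → X → EReal) :
    X → EReal :=
  fun u => extendedIntegral μ (fun t => f t u)

end

/-! Subtracting the smooth minorant gives a nonnegative integrand `F = f - g` with `I_f = ∫ F + ∫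
g`, and the second term is Fréchet differentiable. So `x' - ∫ ∇g_t(x)` is a Fréchet subgradient of
`∫ F` at `x`. It is enough to treat `F` and add the gradients `∇g_t` back afterwards, the sum rule
being exact for a differentiable summand. Weak-* continuity reduces `ρ` to the values of functionals
on a finite-dimensional subspace `L` (`Seminorm.exists_finiteDimensional_bound`). A change of
density (`exists_seq_isFrechetSubgradient_sigmaFinite`) makes the measure finite and gives `F t x ≤
1`.

The core is a decoupling. In `∫ F t (x + e)` the common point `x + e`, `e ∈ L`, is replaced by a
free measurable map `u`, and with `x'` now the shifted functional one minimizes `∫ (F t (u t) + κ ‖u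
t - (x + e)‖²) - x' e + 2ε ‖e‖` over `u` and `e`. Infinite-dimensional `L²` lacks compactness, so a
Borwein–Preiss principle (`exists_minimizer_add_tsum_gauge`, `exists_joint_minimizer`) supplies a
minimizer of a slightly perturbed problem.

With `e` frozen, `u` minimizes an integral over all measurable maps, so by measurable selection `u
t` minimizes the integrand for almost every `t` (`ae_forall_le_of_lintegral_le`). The penalty is
differentiable because the norm is, and minus its derivative is a Fréchet subgradient `ξ t` of `F t`
at `u t`. With `u` frozen, stationarity in `e` says that `∫ ξ` is close to `x'` on `L`
(`exists_penalized_subgradient`).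

As `κ → ∞`, compactness in `L` gives `e → e₀` and `u → x + e₀` along a subsequence. The subgradient
inequality with slope `ε` against the penalty `2ε` forces `e₀ = 0`. The value estimate then yields
convergence of `F t (u t)` in `L¹` and `κ ∫ ‖u - (x + e)‖² → 0`. The latter is the product estimate
(c), since `‖ξ‖` is at most `2κ ‖u - (x + e)‖` up to a vanishing term. -/

/-! ### Measurable selection from measurable sets in a product. -/

section MeasurableSelection

/-- The Baire space embeds continuously into the real line. -/
theorem exists_continuous_injective_baire_real :
    ∃ θ : (ℕ → ℕ) → ℝ, Continuous θ ∧ Function.Injective θ := by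
  -- The bits of `b σ` record all comparisons `σ i ≤ m`, which determine `σ`; each bit depends on
  -- one coordinate. Ratio `1 / 3 < 1 / 2` makes the Cantor series injective.
  let b : (ℕ → ℕ) → ℕ → Bool := fun σ k => decide (σ k.unpair.1 ≤ k.unpair.2)
  refine ⟨fun σ => Cardinal.cantorFunction (1 / 3) (b σ), ?_, ?_⟩
  · have hs : Summable fun n : ℕ => (1 / 3 : ℝ) ^ n :=
      summable_geometric_of_lt_one (by norm_num) (by norm_num)
    refine continuous_tsum (fun k => ?_) hs (fun k σ => ?_)
    · have h : Continuous fun m : ℕ => cond (decide (m ≤ k.unpair.2)) ((1 / 3 : ℝ) ^ k) 0 :=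
        continuous_of_discreteTopology
      exact h.comp (continuous_apply k.unpair.1)
    · cases h : b σ k <;> simp [Cardinal.cantorFunctionAux, h]
  · intro σ τ h
    have hb : b σ = b τ := Cardinal.cantorFunction_injective (by norm_num) (by norm_num) h
    funext i
    have key : ∀ m, σ i ≤ m ↔ τ i ≤ m := fun m => by
      have := congrFun hb (Nat.pair i m)
      simpa [b] using this
    exact le_antisymm ((key _).2 le_rfl) ((key _).1 le_rfl)

/-- A continuous map on a compact subset of the Baire space has a Borel section. -/
theorem exists_measurable_section_of_isCompact {Y : Type*} [TopologicalSpace Y] [T2Space Y]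
    [MeasurableSpace Y] [BorelSpace Y] {p : (ℕ → ℕ) → Y} (hp : Continuous p)
    {C : Set (ℕ → ℕ)} (hC : IsCompact C) :
    ∃ s : Y → (ℕ → ℕ), Measurable s ∧ ∀ y ∈ p '' C, s y ∈ C ∧ p (s y) = y := by
  classical
  obtain ⟨θ, hθ, hinj⟩ := exists_continuous_injective_baire_real
  -- In each compact fibre the point with least `θ` is chosen; injectivity of `θ` is what later
  -- transfers measurability from `θ ∘ s` to `s`.
  have hmin : ∀ y, ∃ σ, y ∈ p '' C →
      (σ ∈ C ∧ p σ = y) ∧ ∀ τ ∈ C, p τ = y → θ σ ≤ θ τ := by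
    intro y
    by_cases hy : y ∈ p '' C
    · have hK : IsCompact (C ∩ p ⁻¹' {y}) := hC.inter_right (isClosed_singleton.preimage hp)
      obtain ⟨τ, hτ, hτy⟩ := hy
      obtain ⟨σ, hσ, hσm⟩ := hK.exists_isMinOn ⟨τ, hτ, hτy⟩ hθ.continuousOn
      exact ⟨σ, fun _ => ⟨hσ, fun τ h1 h2 => hσm ⟨h1, h2⟩⟩⟩
    · exact ⟨0, fun h => absurd h hy⟩
  choose s hs using hmin
  have himg : ∀ K : Set (ℕ → ℕ), IsClosed K → MeasurableSet (p '' (C ∩ K)) := fun K hK =>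
    ((hC.inter_right hK).image hp).isClosed.measurableSet
  have hpC : MeasurableSet (p '' C) := (hC.image hp).isClosed.measurableSet
  have hm : Measurable fun y : p '' C => θ (s y) := by
    refine measurable_of_Iic fun c => ?_
    have : (fun y : p '' C => θ (s y)) ⁻¹' Set.Iic c
        = Subtype.val ⁻¹' (p '' (C ∩ θ ⁻¹' Set.Iic c)) := by
      ext ⟨y, hy⟩
      constructor
      · intro h
        exact ⟨s y, ⟨(hs y hy).1.1, h⟩, (hs y hy).1.2⟩
      · rintro ⟨σ, ⟨hσ, hσc⟩, hσy⟩
        exact ((hs y hy).2 σ hσ hσy).trans hσc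
    rw [this]
    exact measurable_subtype_coe (himg _ (isClosed_Iic.preimage hθ))
  have hsm : Measurable fun y : p '' C => s y := by
    -- `s y ∈ Z` is equivalent to `θ (s y)` lying in the compact set `θ '' (C ∩ Z)`.
    refine measurable_of_isClosed fun Z hZ => ?_
    have : (fun y : p '' C => s y) ⁻¹' Z = (fun y : p '' C => θ (s y)) ⁻¹' (θ '' (C ∩ Z)) := by
      ext ⟨y, hy⟩
      constructor
      · intro h
        exact ⟨s y, ⟨(hs y hy).1.1, h⟩, rfl⟩
      · rintro ⟨σ, ⟨-, hσ⟩, h⟩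
        have h' := hinj h
        simp only at h'
        change s y ∈ Z
        rwa [← h']
    rw [this]
    exact hm ((hC.inter_right hZ).image hθ).isClosed.measurableSet
  refine ⟨fun y => if y ∈ p '' C then s y else 0, ?_, fun y hy => ?_⟩
  · refine measurable_of_restrict_of_restrict_compl hpC ?_ ?_
    · rw [Set.domRestrict_ite]
      exact hsm
    · rw [Set.domRestrict_ite_compl]
      exact measurable_const
  · simpa [hy] using (hs y hy).1

/-- The image of the Baire space under a continuous map is approximated from inside, in measure, by
images of compact sets. -/
theorem exists_isCompact_lt_measure_image_baire {Y : Type*} [TopologicalSpace Y]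
    [MeasurableSpace Y] [BorelSpace Y] (ν : Measure Y) [ν.OuterRegular]
    {p : (ℕ → ℕ) → Y} (hp : Continuous p) {a : ℝ≥0∞} (ha : a < ν (Set.range p)) :
    ∃ C : Set (ℕ → ℕ), IsCompact C ∧ a ≤ ν (p '' C) := by
  -- Choquet's capacitability argument: continuity from below, valid for arbitrary sets, allows
  -- bounding one coordinate at a time while keeping measure above `a`.
  have step : ∀ (n : ℕ) (D : Set (ℕ → ℕ)), a < ν (p '' D) →
      ∃ j, a < ν (p '' (D ∩ {σ | σ n ≤ j})) := by
    intro n D hD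
    have hmono : Monotone fun j => p '' (D ∩ {σ | σ n ≤ j}) := fun i j hij =>
      Set.image_mono (Set.inter_subset_inter_right _ fun σ (h : σ n ≤ i) => h.trans hij)
    have hU : p '' D = ⋃ j, p '' (D ∩ {σ | σ n ≤ j}) := by
      rw [← Set.image_iUnion, ← Set.inter_iUnion]
      congr 1
      ext σ
      simp only [Set.mem_inter_iff, Set.mem_iUnion, Set.mem_ofPred_eq, iff_self_and]
      exact fun _ => ⟨σ n, le_rfl⟩
    rw [hU, hmono.measure_iUnion] at hD
    exact lt_iSup_iff.1 hD
  choose! k hk using step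
  let D : ℕ → Set (ℕ → ℕ) := fun n => Nat.rec Set.univ (fun n E => E ∩ {σ | σ n ≤ k n E}) n
  have hD : ∀ n, a < ν (p '' D n) := by
    intro n
    induction n with
    | zero => simpa [D] using ha
    | succ n ih => exact hk n (D n) ih
  have hDmem : ∀ n σ, σ ∈ D n ↔ ∀ i < n, σ i ≤ k i (D i) := by
    intro n σ
    induction n with
    | zero => simp [D]
    | succ n ih =>
      change σ ∈ D n ∧ σ n ≤ k n (D n) ↔ _
      rw [ih, Nat.forall_lt_succ_right]
  let C : Set (ℕ → ℕ) := Set.univ.pi fun i => Set.Iic (k i (D i))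
  have hC : IsCompact C := isCompact_univ_pi fun i => (Set.finite_Iic _).isCompact
  refine ⟨C, hC, ?_⟩
  rw [Set.measure_eq_iInf_isOpen]
  refine le_iInf₂ fun U hU => le_iInf fun hUo => ?_
  -- Otherwise there are points of `D n` outside `p ⁻¹' U`. Truncated to `0` beyond index `n` they
  -- lie in the compact `C`, and truncation does not change coordinatewise limits, so a subsequence
  -- converges into `C ⊆ p ⁻¹' U`, a contradiction.
  suffices h : ∃ n, D n ⊆ p ⁻¹' U by
    obtain ⟨n, hn⟩ := h
    exact (hD n).le.trans (measure_mono (Set.image_subset_iff.2 hn))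
  by_contra! hcon
  choose σ hσD hσU using fun n => Set.not_subset.1 (hcon n)
  let τ : ℕ → ℕ → ℕ := fun n i => if i < n then σ n i else 0
  have hτC : ∀ n, τ n ∈ C := by
    intro n i _
    by_cases hi : i < n
    · simpa [τ, hi] using (hDmem n _).1 (hσD n) i hi
    · simp [τ, hi]
  obtain ⟨τ₀, hτ₀, φ, hφ, hlim⟩ := hC.tendsto_subseq hτC
  have hσlim : Tendsto (σ ∘ φ) atTop (𝓝 τ₀) := by
    rw [tendsto_pi_nhds] at hlim ⊢
    intro i
    refine (hlim i).congr' ?_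
    filter_upwards [eventually_gt_atTop i] with n hn
    have : i < φ n := hn.trans_le (hφ.id_le n)
    simp [τ, this]
  have hnhds : p ⁻¹' U ∈ 𝓝 τ₀ := (hUo.preimage hp).mem_nhds (hU ⟨τ₀, hτ₀, rfl⟩)
  obtain ⟨n, hn⟩ := (hσlim.eventually hnhds).exists
  exact hσU _ hn

/-- Measurable selection in a Borel subset of a product of Polish spaces. -/
theorem MeasurableSet.exists_measurable_selection_polish {Y X : Type*}
    [TopologicalSpace Y] [PolishSpace Y] [MeasurableSpace Y] [BorelSpace Y]
    [TopologicalSpace X] [PolishSpace X] [MeasurableSpace X] [BorelSpace X] [Nonempty X]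
    (ν : Measure Y) [IsFiniteMeasure ν] {B : Set (Y × X)} (hB : MeasurableSet B) :
    ∃ s : Y → X, Measurable s ∧ ∀ᵐ y ∂ν, (∃ v, (y, v) ∈ B) → (y, s y) ∈ B := by
  classical
  have hBa := hB.analyticSet
  rw [AnalyticSet] at hBa
  rcases hBa with rfl | ⟨h, hh, rfl⟩
  · exact ⟨fun _ => Classical.arbitrary X, measurable_const, by simp⟩
  set p : (ℕ → ℕ) → Y := fun σ => (h σ).1 with hpdef
  have hp : Continuous p := continuous_fst.comp hh
  let := TopologicalSpace.upgradeIsCompletelyMetrizable Y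
  have hcomp : ∀ n : ℕ, ∃ C : Set (ℕ → ℕ), IsCompact C ∧
      ν (Set.range p) ≤ ν (p '' C) + (n + 1 : ℝ≥0∞)⁻¹ := by
    intro n
    by_cases h0 : ν (Set.range p) = 0
    · exact ⟨∅, isCompact_empty, by simp [h0]⟩
    · have hlt : ν (Set.range p) - (n + 1 : ℝ≥0∞)⁻¹ < ν (Set.range p) :=
        ENNReal.sub_lt_self (measure_ne_top _ _) h0 (by simp)
      obtain ⟨C, hC, hCa⟩ := exists_isCompact_lt_measure_image_baire ν hp hlt
      exact ⟨C, hC, tsub_le_iff_right.1 hCa⟩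
  choose C hC hCν using hcomp
  choose s hs hsC using fun n => exists_measurable_section_of_isCompact hp (hC n)
  have hmeas : ∀ n, MeasurableSet (p '' C n) := fun n => ((hC n).image hp).isClosed.measurableSet
  have hnull : ν (Set.range p \ ⋃ n, p '' C n) = 0 := by
    have hle : ∀ n : ℕ, ν (Set.range p \ ⋃ n, p '' C n) ≤ (n + 1 : ℝ≥0∞)⁻¹ := by
      intro n
      refine (measure_mono (Set.sdiff_subset_sdiff_right (Set.subset_iUnion _ n))).trans ?_
      rw [measure_sdiff (Set.image_subset_range _ _) (hmeas n).nullMeasurableSet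
        (measure_ne_top _ _)]
      exact tsub_le_iff_left.2 (hCν n)
    have hlim := (ENNReal.tendsto_inv_nat_nhds_zero).comp (tendsto_add_atTop_nat 1)
    refine le_antisymm (ge_of_tendsto' hlim fun n => ?_) zero_le
    simpa using hle n
  have hcov : ∀ y, ∃ n, (y ∈ ⋃ n, p '' C n) → y ∈ p '' C n := by
    intro y
    by_cases hy : y ∈ ⋃ n, p '' C n
    · obtain ⟨n, hn⟩ := Set.mem_iUnion.1 hy
      exact ⟨n, fun _ => hn⟩
    · exact ⟨0, fun h => absurd h hy⟩
  -- The second alternative makes the search succeed off the union as well, so `Nat.find` is a total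
  -- measurable index.
  let P : Y → ℕ → Prop := fun y n => y ∈ p '' C n ∨ y ∉ ⋃ n, p '' C n
  have hP : ∀ y, ∃ n, P y n := fun y => by
    obtain ⟨n, hn⟩ := hcov y
    refine ⟨n, ?_⟩
    by_cases hy : y ∈ ⋃ n, p '' C n
    · exact Or.inl (hn hy)
    · exact Or.inr hy
  let N : Y → ℕ := fun y => Nat.find (hP y)
  have hN : Measurable N := measurable_find hP fun n =>
    (hmeas n).union (MeasurableSet.iUnion hmeas).compl
  have hsel : Measurable fun y => s (N y) y :=
    (measurable_from_prod_countable_right (f := fun q : ℕ × Y => s q.1 q.2) hs).comp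
      (hN.prodMk measurable_id)
  refine ⟨fun y => (h (s (N y) y)).2, (continuous_snd.comp hh).measurable.comp hsel, ?_⟩
  have hae : ∀ᵐ y ∂ν, y ∉ Set.range p \ ⋃ n, p '' C n := measure_eq_zero_iff_ae_notMem.1 hnull
  filter_upwards [hae] with y hy hex
  obtain ⟨v, σ, hσ⟩ := hex
  have hyr : y ∈ Set.range p := ⟨σ, by simp [hpdef, hσ]⟩
  have hyU : y ∈ ⋃ n, p '' C n := by
    by_contra hn
    exact hy ⟨hyr, hn⟩
  have hyN : y ∈ p '' C (N y) := (Nat.find_spec (hP y)).resolve_right fun h => h hyU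
  exact ⟨s (N y) y, Prod.ext (hsC _ y hyN).2 rfl⟩

/-- A measurable subset of a product is, in its first variable, the preimage of a Borel set under
a measurable map into the Cantor space. -/
theorem MeasurableSet.exists_eq_preimage_cantor {T X : Type*} [MeasurableSpace T]
    [MeasurableSpace X] {A : Set (T × X)} (hA : MeasurableSet A) :
    ∃ φ : T → (ℕ → Bool), Measurable φ ∧
      ∃ B : Set ((ℕ → Bool) × X), MeasurableSet B ∧ A = (Prod.map φ id) ⁻¹' B := by
  classical
  refine MeasurableSpace.induction_on_inter (C := fun A _ => ∃ φ : T → (ℕ → Bool), Measurable φ ∧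
      ∃ B : Set ((ℕ → Bool) × X), MeasurableSet B ∧ A = (Prod.map φ id) ⁻¹' B)
    generateFrom_prod.symm isPiSystem_prod ?_ ?_ ?_ ?_ A hA
  · exact ⟨fun _ _ => true, measurable_const, ∅, .empty, rfl⟩
  · rintro _ ⟨E, hE, G, hG, rfl⟩
    refine ⟨fun t _ => decide (t ∈ E), ?_, {c | c 0 = true} ×ˢ G, ?_, ?_⟩
    · exact measurable_pi_lambda _ fun _ => measurable_to_bool (by simpa [Set.preimage] using hE)
    · have h0 : Measurable fun c : ℕ → Bool => c 0 := measurable_pi_apply 0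
      exact (h0 (measurableSet_singleton true)).prod hG
    · ext ⟨t, v⟩
      simp
  · rintro _ _ ⟨φ, hφ, B, hB, rfl⟩
    exact ⟨φ, hφ, Bᶜ, hB.compl, rfl⟩
  · intro A' _ _ hA'
    choose φ hφ B hB hAB using hA'
    -- The countably many codes are interleaved through `Nat.unpair`, and each is recovered
    -- measurably from the combined code.
    refine ⟨fun t k => φ k.unpair.1 t k.unpair.2, ?_,
      ⋃ n, (Prod.map (fun c m => c (Nat.pair n m)) id) ⁻¹' B n, ?_, ?_⟩
    · exact measurable_pi_lambda _ fun k => (measurable_pi_apply _).comp (hφ _)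
    · refine MeasurableSet.iUnion fun n => ?_
      refine (Measurable.prodMap ?_ measurable_id) (hB n)
      exact measurable_pi_lambda _ fun m => measurable_pi_apply _
    · rw [Set.preimage_iUnion]
      refine Set.iUnion_congr fun n => ?_
      rw [hAB n, ← Set.preimage_comp]
      congr 1
      ext q
      · simp
      · simp

/-- The Aumann–von Neumann measurable selection theorem, almost everywhere. -/
theorem MeasurableSet.exists_measurable_selection {T X : Type*} [MeasurableSpace T]
    [TopologicalSpace X] [PolishSpace X] [MeasurableSpace X] [BorelSpace X] [Nonempty X]
    (μ : Measure T) [IsFiniteMeasure μ] {A : Set (T × X)} (hA : MeasurableSet A) :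
    ∃ s : T → X, Measurable s ∧ ∀ᵐ t ∂μ, (∃ v, (t, v) ∈ A) → (t, s t) ∈ A := by
  obtain ⟨φ, hφ, B, hB, rfl⟩ := hA.exists_eq_preimage_cantor
  have : TopologicalSpace.SeparableSpace (ℕ → Bool) := inferInstance
  have : TopologicalSpace.IsCompletelyMetrizableSpace (ℕ → Bool) := inferInstance
  obtain ⟨s, hs, hsB⟩ := hB.exists_measurable_selection_polish (μ.map φ)
  exact ⟨s ∘ φ, hs.comp hφ, ae_of_ae_map hφ.aemeasurable hsB⟩

end MeasurableSelection

/-! ### A smooth variational principle. -/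

section VariationalPrinciple

/-- A variational principle of Borwein–Preiss type, for a gauge `ρ`. -/
theorem exists_minimizer_add_tsum_gauge {M : Type*} [PseudoEMetricSpace M] [CompleteSpace M]
    (Φ : M → ℝ≥0∞) (hΦ : LowerSemicontinuous Φ) (z₀ : M) (h₀ : Φ z₀ ≠ ∞)
    (ρ : M → M → ℝ≥0∞) (hρ₀ : ∀ z, ρ z z = 0) (hρc : ∀ z', Continuous fun z => ρ z z')
    (hρ : ∀ ε ≠ 0, ∃ δ ≠ 0, ∀ z z', ρ z z' ≤ δ → edist z z' ≤ ε)
    (δ : ℕ → ℝ≥0∞) (hδ₀ : ∀ k, δ k ≠ 0) (hδ : ∀ k, δ k ≤ 1) :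
    ∃ (z : ℕ → M) (w : M), (∀ k, Φ (z k) ≤ Φ z₀) ∧
      ∀ z', Φ w + ∑' k, δ k * ρ w (z k) ≤ Φ z' + ∑' k, δ k * ρ z' (z k) := by
  have hδt : ∀ k, δ k ≠ ∞ := fun k => ne_top_of_le_ne_top ENNReal.one_ne_top (hδ k)
  have hpick : ∀ (φ : M → ℝ≥0∞) (p : M) (η : ℝ≥0∞), ∃ q, φ p ≠ ∞ → η ≠ 0 →
      φ q ≤ φ p ∧ ∀ z, φ q ≤ φ z + η := by
    intro φ p η
    by_cases hp : ∀ z, φ p ≤ φ z + η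
    · exact ⟨p, fun _ _ => ⟨le_rfl, hp⟩⟩
    · by_cases hη : η = 0
      · exact ⟨p, fun _ h => absurd hη h⟩
      push Not at hp
      obtain ⟨z, hz⟩ := hp
      by_cases hpt : φ p = ∞
      · exact ⟨p, fun h => absurd hpt h⟩
      have hinf : ⨅ z, φ z ≠ ∞ := ne_top_of_le_ne_top hpt (iInf_le _ p)
      obtain ⟨q, hq⟩ := iInf_lt_iff.1 (ENNReal.lt_add_right hinf hη)
      refine ⟨q, fun _ _ => ⟨?_, fun z' => ?_⟩⟩
      · exact hq.le.trans (le_trans (add_le_add_left (iInf_le _ z) _) hz.le)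
      · exact hq.le.trans (add_le_add_left (iInf_le _ z') _)
  choose pick hpick using hpick
  let τ : ℕ → ℝ≥0∞ := fun k => ((k + 1 : ℕ) : ℝ≥0∞)⁻¹
  have hτ₀ : ∀ k, τ k ≠ 0 := fun k => ENNReal.inv_ne_zero.2 (ENNReal.natCast_ne_top _)
  have hτ : Tendsto τ atTop (𝓝 0) :=
    ENNReal.tendsto_inv_nat_nhds_zero.comp (tendsto_add_atTop_nat 1)
  let η : ℕ → ℝ≥0∞ := fun k => δ k * τ k
  have hη₀ : ∀ k, η k ≠ 0 := fun k => mul_ne_zero (hδ₀ k) (hτ₀ k)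
  -- The state carries the function perturbed so far and an `η n`-minimizer of it, chosen no worse
  -- than the previous point. The choice `η n = δ n * τ n` is what bounds `ρ y (z n)` by `τ n` on
  -- the sublevel set `S n`.
  let st : ℕ → (M → ℝ≥0∞) × M := fun n => Nat.rec (Φ, pick Φ z₀ (η 0))
    (fun k s => (fun z => s.1 z + δ k * ρ z s.2,
      pick (fun z => s.1 z + δ k * ρ z s.2) s.2 (η (k + 1)))) n
  let φ : ℕ → M → ℝ≥0∞ := fun n => (st n).1
  let z : ℕ → M := fun n => (st n).2
  have hφs : ∀ n y, φ (n + 1) y = φ n y + δ n * ρ y (z n) := fun n y => rfl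
  have hφz : ∀ n, φ (n + 1) (z n) = φ n (z n) := fun n => by simp [hφs, hρ₀]
  have hz0 : φ 0 (z 0) ≤ Φ z₀ ∧ ∀ y, φ 0 (z 0) ≤ φ 0 y + η 0 := hpick Φ z₀ (η 0) h₀ (hη₀ 0)
  have hz : ∀ n, φ n (z n) ≠ ∞ ∧ (∀ y, φ n (z n) ≤ φ n y + η n) ∧
      φ (n + 1) (z (n + 1)) ≤ φ n (z n) := by
    intro n
    have aux : ∀ n, φ n (z n) ≠ ∞ → φ (n + 1) (z (n + 1)) ≤ φ (n + 1) (z n) ∧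
        ∀ y, φ (n + 1) (z (n + 1)) ≤ φ (n + 1) y + η (n + 1) := fun n hn =>
      hpick (φ (n + 1)) (z n) (η (n + 1)) (by rwa [hφz]) (hη₀ _)
    induction n with
    | zero =>
      have h := ne_top_of_le_ne_top h₀ hz0.1
      exact ⟨h, hz0.2, (aux 0 h).1.trans (hφz 0).le⟩
    | succ n ih =>
      have h := ne_top_of_le_ne_top ih.1 ih.2.2
      exact ⟨h, (aux n ih.1).2, (aux (n + 1) h).1.trans (hφz (n + 1)).le⟩
  have hanti : Antitone fun n => φ n (z n) := antitone_nat_of_succ_le fun n => (hz n).2.2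
  have hφsum : ∀ n y, φ n y = Φ y + ∑ i ∈ Finset.range n, δ i * ρ y (z i) := by
    intro n y
    induction n with
    | zero => simp [φ, st]
    | succ n ih => rw [hφs, ih, Finset.sum_range_succ, add_assoc]
  have hφmono : ∀ y, Monotone fun n => φ n y := fun y => monotone_nat_of_le_succ fun n => by
    simp only [hφs]
    exact le_self_add
  let S : ℕ → Set M := fun n => {y | φ (n + 1) y ≤ φ n (z n)}
  have hS : ∀ n, IsClosed (S n) := by
    intro n
    have hl : LowerSemicontinuous (φ (n + 1)) := by
      have : φ (n + 1) = fun y => Φ y + ∑ i ∈ Finset.range (n + 1), δ i * ρ y (z i) :=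
        funext (hφsum (n + 1))
      rw [this]
      refine hΦ.add (Continuous.lowerSemicontinuous ?_)
      exact continuous_finsetSum _ fun i _ =>
        (ENNReal.continuous_const_mul (hδt i)).comp (hρc (z i))
    exact hl.isClosed_preimage _
  have hSρ : ∀ n, ∀ y ∈ S n, ρ y (z n) ≤ τ n := by
    intro n y hy
    have h1 : φ n y + δ n * ρ y (z n) ≤ φ n y + δ n * τ n := by
      rw [← hφs]
      exact le_trans hy ((hz n).2.1 y)
    have h2 : φ n y ≠ ∞ := by
      refine ne_top_of_le_ne_top (hz n).1 (le_trans ?_ hy)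
      exact hφmono y n.le_succ
    exact (ENNReal.mul_le_mul_iff_right (hδ₀ n) (hδt n)).1 ((ENNReal.add_le_add_iff_left h2).1 h1)
  have hzS : ∀ n m, n ≤ m → z m ∈ S n := by
    intro n m hnm
    rcases hnm.eq_or_lt with rfl | hlt
    · exact (hφz n).le
    · exact (hφmono _ hlt).trans (hanti hnm)
  have hcauchy : CauchySeq z := by
    rw [EMetric.cauchySeq_iff']
    intro ε hε
    obtain ⟨ε', hε', hlt⟩ := exists_between hε
    obtain ⟨d, hd, h⟩ := hρ ε' hε'.ne'
    obtain ⟨N, hN⟩ := (hτ.eventually (ge_mem_nhds (pos_iff_ne_zero.2 hd))).exists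
    exact ⟨N, fun n hn => (h _ _ ((hSρ N _ (hzS N n hn)).trans hN)).trans_lt hlt⟩
  obtain ⟨w, hw⟩ := cauchySeq_tendsto_of_complete hcauchy
  have hwS : ∀ n, w ∈ S n := fun n =>
    (hS n).mem_of_tendsto hw ((eventually_ge_atTop n).mono fun m hm => hzS n m hm)
  refine ⟨z, w, fun k => ?_, fun y => ?_⟩
  · refine le_trans ?_ ((hanti (Nat.zero_le k)).trans hz0.1)
    change Φ (z k) ≤ φ k (z k)
    rw [hφsum]
    exact le_self_add
  -- Every partial perturbation at `w` is below `φ j (z j)` since `w` lies in all the `S n`, and `φ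
  -- j (z j)` is within `η j ≤ τ j` of the infimum of `φ j`.
  · have h1 : ∀ j, Φ w + ∑' k, δ k * ρ w (z k) ≤ φ j (z j) := by
      intro j
      rw [ENNReal.tsum_eq_iSup_nat, ENNReal.add_iSup]
      refine iSup_le fun k => ?_
      rw [← hφsum]
      calc φ k w ≤ φ (max k j + 1) w := hφmono w ((le_max_left k j).trans (Nat.le_succ _))
        _ ≤ φ (max k j) (z (max k j)) := hwS _
        _ ≤ φ j (z j) := hanti (le_max_right _ _)
    have h2 : ∀ j, Φ w + ∑' k, δ k * ρ w (z k) ≤ Φ y + ∑' k, δ k * ρ y (z k) + τ j := by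
      intro j
      refine (h1 j).trans (((hz j).2.1 y).trans (add_le_add ?_ ?_))
      · rw [hφsum]
        gcongr
        exact ENNReal.sum_le_tsum _
      · exact (mul_le_mul_left (hδ j) _).trans (one_mul _).le
    refine ge_of_tendsto' (f := fun j => Φ y + ∑' k, δ k * ρ y (z k) + τ j) (x := atTop) ?_ h2
    simpa using hτ.const_add (Φ y + ∑' k, δ k * ρ y (z k))

end VariationalPrinciple

/-! ### Derivative of the squared norm and first-order conditions. -/

section FrechetCalculus

variable {X : Type*} [NormedAddCommGroup X] [NormedSpace ℝ X]

/-- If the norm is `C¹` away from the origin, its square is `C¹`. -/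
theorem exists_hasFDerivAt_norm_sq (hnorm : ContDiffOn ℝ 1 (fun u : X => ‖u‖) {0}ᶜ) :
    ∃ J : X → StrongDual ℝ X, (∀ v, HasFDerivAt (fun u : X => ‖u‖ ^ 2) (J v) v) ∧
      Continuous J ∧ ∀ v, ‖J v‖ ≤ 2 * ‖v‖ := by
  have hopen : IsOpen ({0}ᶜ : Set X) := isOpen_compl_singleton
  -- The factor `2 * ‖v‖` vanishes at the origin, where the value of `fderiv` carries no
  -- information.
  let J : X → StrongDual ℝ X := fun v => (2 * ‖v‖) • fderiv ℝ (fun u : X => ‖u‖) v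
  have hJ : ∀ v, ‖J v‖ ≤ 2 * ‖v‖ := by
    intro v
    rw [norm_smul, Real.norm_of_nonneg (by positivity)]
    have : ‖fderiv ℝ (fun u : X => ‖u‖) v‖ ≤ 1 := by
      simpa using norm_fderiv_le_of_lipschitz ℝ (x₀ := v) (lipschitzWith_one_norm (E := X))
    exact mul_le_of_le_one_right (by positivity) this
  refine ⟨J, fun v => ?_, continuous_iff_continuousAt.2 fun v => ?_, hJ⟩
  · by_cases hv : v = 0
    · subst hv
      have : J 0 = 0 := by simp [J]
      rw [this]
      refine HasFDerivAt.of_isLittleO ?_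
      simpa using Asymptotics.isLittleO_norm_pow_id (E' := X) one_lt_two
    · have hd : DifferentiableAt ℝ (fun u : X => ‖u‖) v :=
        (hnorm.differentiableOn one_ne_zero).differentiableAt (hopen.mem_nhds hv)
      simpa [J] using hd.hasFDerivAt.pow 2
  · by_cases hv : v = 0
    · subst hv
      have h0 : J 0 = 0 := by simp [J]
      rw [ContinuousAt, h0]
      refine squeeze_zero_norm hJ ?_
      have : Continuous fun v : X => 2 * ‖v‖ := by fun_prop
      simpa using this.tendsto 0
    · have hc : ContinuousAt (fderiv ℝ (fun u : X => ‖u‖)) v :=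
        (hnorm.continuousOn_fderiv_of_isOpen hopen le_rfl).continuousAt (hopen.mem_nhds hv)
      have h2 : ContinuousAt (fun v : X => 2 * ‖v‖) v := by fun_prop
      exact h2.smul hc

/-- Fréchet subgradients of extended nonnegative functions, in `ε`-form. -/
def IsFrechetSubgradient (F : X → ℝ≥0∞) (x : X) (ξ : StrongDual ℝ X) : Prop :=
  F x ≠ ∞ ∧ ∀ η > 0, ∀ᶠ v in 𝓝 x,
    ENNReal.ofReal ((F x).toReal + ξ (v - x) - η * ‖v - x‖) ≤ F v

/-- Local minimality gives `F v ≥ F x + q x - q v`, and `q x - q v` is `-q' (v - x)` up to `o(‖v -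
x‖)`. Nonnegativity of `q` only serves to state minimality in `ℝ≥0∞`. -/
theorem isFrechetSubgradient_neg_of_isLocalMin {F : X → ℝ≥0∞} {x : X} (hx : F x ≠ ∞)
    {q : X → ℝ} {q' : StrongDual ℝ X} (hq : HasFDerivAt q q' x) (hq₀ : ∀ v, 0 ≤ q v)
    (hmin : ∀ᶠ v in 𝓝 x, F x + ENNReal.ofReal (q x) ≤ F v + ENNReal.ofReal (q v)) :
    IsFrechetSubgradient F x (-q') := by
  refine ⟨hx, fun η hη => ?_⟩
  filter_upwards [hmin, hq.isLittleO.def hη] with v hv hqv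
  by_cases hFv : F v = ∞
  · simp [hFv]
  refine ENNReal.ofReal_le_of_le_toReal ?_
  have h1 := ENNReal.toReal_mono (ENNReal.add_ne_top.2 ⟨hFv, ENNReal.ofReal_ne_top⟩) hv
  rw [ENNReal.toReal_add hx ENNReal.ofReal_ne_top, ENNReal.toReal_add hFv ENNReal.ofReal_ne_top,
    ENNReal.toReal_ofReal (hq₀ _), ENNReal.toReal_ofReal (hq₀ _)] at h1
  have h2 := (abs_le.1 (Real.norm_eq_abs _ ▸ hqv)).2
  simp only [neg_apply]
  linarith

/-- The constant `c` absorbs nonsmooth terms that grow at most linearly along the ray. -/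
theorem HasFDerivAt.nonneg_of_eventually {A : X → ℝ} {A' : StrongDual ℝ X} {w : X}
    (hA : HasFDerivAt A A' w) {d : X} {c : ℝ}
    (h : ∀ᶠ τ in 𝓝[>] (0 : ℝ), 0 ≤ A (w + τ • d) - A w + τ * c) : 0 ≤ A' d + c := by
  have hl : HasDerivAt (fun τ : ℝ => A (w + τ • d)) (A' d) 0 := by
    have h1 : HasDerivAt (fun τ : ℝ => w + τ • d) d 0 := by
      simpa using ((hasDerivAt_id (0 : ℝ)).smul_const d).const_add w
    have h2 : HasFDerivAt A A' (w + (0 : ℝ) • d) := by simpa using hA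
    exact h2.comp_hasDerivAt 0 h1
  have hs : Tendsto (slope (fun τ : ℝ => A (w + τ • d)) 0) (𝓝[>] (0 : ℝ)) (𝓝 (A' d)) :=
    (hasDerivAt_iff_tendsto_slope.1 hl).mono_left
      (nhdsWithin_mono _ fun τ hτ => (Set.mem_Ioi.1 hτ).ne')
  refine ge_of_tendsto (hs.add_const c) ?_
  filter_upwards [h, self_mem_nhdsWithin] with τ hτ hpos
  have hpos' : (0 : ℝ) < τ := hpos
  simp only [slope_def_field, sub_zero, zero_smul, add_zero]
  rw [div_add' _ _ _ hpos'.ne']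
  refine div_nonneg ?_ hpos'.le
  linarith

end FrechetCalculus

/-! ### Exchange of minimization and integration; lower semicontinuity on `L²`. -/

section IntegralMinimization

variable {T X : Type*} [MeasurableSpace T]

/-- A minimizer of an integral functional over all measurable maps minimizes the integrand
pointwise almost everywhere. -/
theorem ae_forall_le_of_lintegral_le [TopologicalSpace X] [PolishSpace X] [MeasurableSpace X]
    [BorelSpace X] (ν : Measure T) [IsFiniteMeasure ν] {Q : T → X → ℝ≥0∞}
    (hQ : Measurable (Function.uncurry Q)) {u : T → X} (hu : Measurable u)
    (hfin : ∫⁻ t, Q t (u t) ∂ν ≠ ∞)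
    (hmin : ∀ u' : T → X, Measurable u' → ∫⁻ t, Q t (u t) ∂ν ≤ ∫⁻ t, Q t (u' t) ∂ν) :
    ∀ᵐ t ∂ν, ∀ v, Q t (u t) ≤ Q t v := by
  classical
  rcases isEmpty_or_nonempty X with hX | hX
  · exact ae_of_all _ fun t => hX.elim (u t)
  have hQu : Measurable fun t => Q t (u t) := hQ.comp (measurable_id.prodMk hu)
  have hA : MeasurableSet {q : T × X | Q q.1 q.2 < Q q.1 (u q.1)} :=
    measurableSet_lt hQ (hQu.comp measurable_fst)
  obtain ⟨s, hs, hsA⟩ := hA.exists_measurable_selection ν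
  have hB : MeasurableSet {t | Q t (s t) < Q t (u t)} :=
    measurableSet_lt (hQ.comp (measurable_id.prodMk hs)) hQu
  -- The competitor switches to the selection only where it is strictly better. Equality of the
  -- finite integrals then confines this set to a null set.
  have hu' : Measurable fun t => if Q t (s t) < Q t (u t) then s t else u t := hs.ite hB hu
  have hle : ∀ t, Q t (if Q t (s t) < Q t (u t) then s t else u t) ≤ Q t (u t) := by
    intro t
    split_ifs with h
    · exact h.le
    · exact le_rfl
  have hae := ae_eq_of_ae_le_of_lintegral_le (ae_of_all ν hle)
    (ne_top_of_le_ne_top hfin (lintegral_mono hle)) hQu.aemeasurable (hmin _ hu')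
  filter_upwards [hae, hsA] with t ht hst v
  by_contra! hv
  have h : Q t (s t) < Q t (u t) := hst ⟨v, hv⟩
  simp only [h, if_true] at ht
  exact h.ne ht

theorem edist_sq_Lp_two [NormedAddCommGroup X] (ν : Measure T) (u u' : Lp X 2 ν) :
    edist u u' ^ 2 = ∫⁻ t, ‖u t - u' t‖ₑ ^ 2 ∂ν := by
  rw [Lp.edist_def]
  have := eLpNorm_nnreal_pow_eq_lintegral (f := ⇑u - ⇑u') (μ := ν) (p := 2) (by norm_num)
  rw [NNReal.coe_ofNat, ENNReal.coe_ofNat] at this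
  simpa only [ENNReal.rpow_ofNat, Pi.sub_apply] using this

variable [NormedAddCommGroup X] [MeasurableSpace X] [BorelSpace X]
  [TopologicalSpace.SeparableSpace X]

/-- Lower semicontinuity on `L²` of an integral functional depending on a parameter. -/
theorem lowerSemicontinuous_lintegral_Lp (ν : Measure T) {E : Type*} [PseudoEMetricSpace E]
    [MeasurableSpace E]
    {H : T → X × E → ℝ≥0∞} (hH : Measurable (Function.uncurry H))
    (hlsc : ∀ t, LowerSemicontinuous (H t)) :
    LowerSemicontinuous fun z : Lp X 2 ν × E => ∫⁻ t, H t (z.1 t, z.2) ∂ν := by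
  have : SecondCountableTopology X := UniformSpace.secondCountable_of_separable X
  rw [lowerSemicontinuous_iff_isClosed_preimage]
  intro c
  -- Convergence in `L²` gives almost everywhere convergence along a subsequence; Fatou's lemma
  -- finishes.
  refine IsSeqClosed.isClosed fun z w hz hzw => ?_
  have h1 : Tendsto (fun n => (z n).1) atTop (𝓝 w.1) := (continuous_fst.tendsto w).comp hzw
  have h2 : Tendsto (fun n => (z n).2) atTop (𝓝 w.2) := (continuous_snd.tendsto w).comp hzw
  obtain ⟨φ, hφ, hae⟩ := (tendstoInMeasure_of_tendsto_Lp h1).exists_seq_tendsto_ae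
  have hm : ∀ n, AEMeasurable (fun t => H t ((z n).1 t, (z n).2)) ν := fun n =>
    (hH.comp (measurable_id.prodMk (((Lp.stronglyMeasurable (z n).1).measurable).prodMk
      measurable_const))).aemeasurable
  change ∫⁻ t, H t (w.1 t, w.2) ∂ν ≤ c
  calc ∫⁻ t, H t (w.1 t, w.2) ∂ν
      ≤ ∫⁻ t, liminf (fun n => H t ((z (φ n)).1 t, (z (φ n)).2)) atTop ∂ν := by
        refine lintegral_mono_ae ?_
        filter_upwards [hae] with t ht
        have hlim : Tendsto (fun n => ((z (φ n)).1 t, (z (φ n)).2)) atTop (𝓝 (w.1 t, w.2)) :=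
          ht.prodMk_nhds (h2.comp hφ.tendsto_atTop)
        refine le_of_forall_lt fun a ha => ?_
        obtain ⟨b, hab, hb⟩ := exists_between ha
        exact hab.trans_le (le_liminf_of_le (by isBoundedDefault)
          ((hlim.eventually (hlsc t _ b hb)).mono fun n hn => hn.le))
    _ ≤ liminf (fun n => ∫⁻ t, H t ((z (φ n)).1 t, (z (φ n)).2) ∂ν) atTop :=
        lintegral_liminf_le' fun n => hm (φ n)
    _ ≤ c := liminf_le_of_le (by isBoundedDefault) fun b hb => by
        obtain ⟨n, hn⟩ := hb.exists
        exact hn.trans (hz (φ n))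

end IntegralMinimization

/-! ### Existence of a minimizer of the decoupled problem. -/

section JointMinimization

variable {T X : Type*} [MeasurableSpace T] [NormedAddCommGroup X] [NormedSpace ℝ X]
  [CompleteSpace X] [MeasurableSpace X] [BorelSpace X] [TopologicalSpace.SeparableSpace X]

/-- A decoupled integral functional, coupled with a finite-dimensional parameter by a quadratic
penalty, has a joint minimizer after a small quadratic perturbation. -/
theorem exists_joint_minimizer (ν : Measure T) [IsFiniteMeasure ν]
    (L : Submodule ℝ X) [FiniteDimensional ℝ L] (x : X)
    {G : T → X → ℝ≥0∞} (hG : Measurable (Function.uncurry G))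
    (hGl : ∀ t, LowerSemicontinuous (G t)) (hGx : ∀ t v, G t v ≠ ∞ → ‖v - x‖ ≤ 1)
    (hGfin : ∫⁻ t, G t x ∂ν ≠ ∞)
    {Ψ : L → ℝ≥0∞} (hΨ : LowerSemicontinuous Ψ) (hΨ₀ : Ψ 0 ≠ ∞) (hΨ₁ : ∀ e, Ψ e ≠ ∞ → ‖e‖ ≤ 1)
    {κ : ℝ≥0∞} (hκ : κ ≠ ∞)
    {δ : ℕ → ℝ≥0∞} (hδ₀ : ∀ k, δ k ≠ 0) (hδ₁ : ∀ k, δ k ≤ 1) (hδ : ∑' k, δ k ≠ ∞) :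
    ∃ (u : T → X) (e : L) (us : ℕ → T → X) (es : ℕ → L),
      Measurable u ∧ (∀ k, Measurable (us k)) ∧ (∀ t, ‖u t - x‖ ≤ 1) ∧
      (∀ k t, ‖us k t - x‖ ≤ 1) ∧ (∀ k, ‖es k‖ ≤ 1) ∧
      (∀ (u' : T → X) (e' : L), Measurable u' →
        ∫⁻ t, (G t (u t) + κ * ‖u t - (x + e)‖ₑ ^ 2) ∂ν + Ψ e +
            ∑' k, δ k * (∫⁻ t, ‖u t - us k t‖ₑ ^ 2 ∂ν + ‖e - es k‖ₑ) ≤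
          ∫⁻ t, (G t (u' t) + κ * ‖u' t - (x + e')‖ₑ ^ 2) ∂ν + Ψ e' +
            ∑' k, δ k * (∫⁻ t, ‖u' t - us k t‖ₑ ^ 2 ∂ν + ‖e' - es k‖ₑ)) ∧
      ∫⁻ t, (G t (u t) + κ * ‖u t - (x + e)‖ₑ ^ 2) ∂ν + Ψ e +
          ∑' k, δ k * (∫⁻ t, ‖u t - us k t‖ₑ ^ 2 ∂ν + ‖e - es k‖ₑ) ≤
        ∫⁻ t, G t x ∂ν + Ψ 0 + (∑' k, δ k) * (ν Set.univ + 1) := by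
  classical
  have : SecondCountableTopology X := UniformSpace.secondCountable_of_separable X
  have : Fact ((1 : ℝ≥0∞) ≤ 2) := ⟨one_le_two⟩
  have hLc : CompleteSpace L := FiniteDimensional.complete ℝ L
  let H : T → X × L → ℝ≥0∞ := fun t q => G t q.1 + κ * ‖q.1 - (x + q.2)‖ₑ ^ 2
  have hHm : Measurable (Function.uncurry H) := by
    have h1 : Measurable fun p : T × (X × L) => G p.1 p.2.1 :=
      hG.comp (measurable_fst.prodMk (measurable_fst.comp measurable_snd))
    have h2 : Measurable fun p : T × (X × L) => κ * ‖p.2.1 - (x + p.2.2)‖ₑ ^ 2 := by fun_prop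
    exact h1.add h2
  have hHl : ∀ t, LowerSemicontinuous (H t) := by
    intro t
    refine ((hGl t).comp continuous_fst).add (Continuous.lowerSemicontinuous ?_)
    refine (ENNReal.continuous_const_mul hκ).comp ((ENNReal.continuous_pow 2).comp ?_)
    fun_prop
  let Φ : Lp X 2 ν × L → ℝ≥0∞ := fun z => ∫⁻ t, H t (z.1 t, z.2) ∂ν + Ψ z.2
  have hΦ : LowerSemicontinuous Φ :=
    (lowerSemicontinuous_lintegral_Lp ν hHm hHl).add (hΨ.comp continuous_snd)
  -- The `L²` distance is squared so that the perturbation is an integral of functions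
  -- differentiable in `u t`. In `L` a Lipschitz perturbation suffices.
  let ρ : Lp X 2 ν × L → Lp X 2 ν × L → ℝ≥0∞ := fun z z' => edist z.1 z'.1 ^ 2 + edist z.2 z'.2
  have hρ : ∀ z z', ρ z z' = ∫⁻ t, ‖z.1 t - z'.1 t‖ₑ ^ 2 ∂ν + ‖z.2 - z'.2‖ₑ := fun z z' => by
    simp only [ρ]
    rw [edist_sq_Lp_two, edist_eq_enorm_sub]
  have hxmem : MemLp (fun _ : T => x) 2 ν := memLp_const x
  have hx : hxmem.toLp _ =ᵐ[ν] fun _ => x := hxmem.coeFn_toLp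
  have hΦ₀ : Φ (hxmem.toLp _, 0) = ∫⁻ t, G t x ∂ν + Ψ 0 := by
    simp only [Φ]
    congr 1
    refine lintegral_congr_ae ?_
    filter_upwards [hx] with t ht
    rw [ht]
    simp [H]
  have hΦ₀t : Φ (hxmem.toLp _, 0) ≠ ∞ := by
    rw [hΦ₀]
    exact ENNReal.add_ne_top.2 ⟨hGfin, hΨ₀⟩
  have hball : ∀ z, Φ z ≠ ∞ → (∀ᵐ t ∂ν, ‖z.1 t - x‖ ≤ 1) ∧ ‖z.2‖ ≤ 1 := by
    intro z hz
    obtain ⟨h1, h2⟩ := ENNReal.add_ne_top.1 hz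
    refine ⟨?_, hΨ₁ _ h2⟩
    have hm : AEMeasurable (fun t => H t (z.1 t, z.2)) ν :=
      (hHm.comp (measurable_id.prodMk ((Lp.stronglyMeasurable z.1).measurable.prodMk
        measurable_const))).aemeasurable
    filter_upwards [ae_lt_top' hm h1] with t ht
    exact hGx t _ (ENNReal.add_ne_top.1 ht.ne).1
  obtain ⟨z, w, hz, hw⟩ := exists_minimizer_add_tsum_gauge Φ hΦ (hxmem.toLp _, 0) hΦ₀t ρ
    (fun z => by simp [ρ]) (fun z' => by
      refine ((ENNReal.continuous_pow 2).comp ?_).add ?_ <;> fun_prop)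
    (fun ε hε => ⟨min (ε ^ 2) ε, by simp [hε], fun z z' h => by
      refine max_le ?_ ?_
      · have : edist z.1 z'.1 ^ 2 ≤ ε ^ 2 := le_self_add.trans (h.trans (min_le_left _ _))
        exact (ENNReal.pow_le_pow_left_iff two_ne_zero).1 this
      · exact le_add_self.trans (h.trans (min_le_right _ _))⟩)
    δ hδ₀ hδ₁
  have hzb : ∀ k, (∀ᵐ t ∂ν, ‖(z k).1 t - x‖ ≤ 1) ∧ ‖(z k).2‖ ≤ 1 := fun k =>
    hball _ (ne_top_of_le_ne_top hΦ₀t (hz k))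
  have hval : Φ w + ∑' k, δ k * ρ w (z k) ≤
      ∫⁻ t, G t x ∂ν + Ψ 0 + (∑' k, δ k) * (ν Set.univ + 1) := by
    refine (hw (hxmem.toLp _, 0)).trans ?_
    rw [hΦ₀, ← ENNReal.tsum_mul_right]
    gcongr with k
    rw [hρ]
    gcongr
    · calc ∫⁻ t, ‖hxmem.toLp _ t - (z k).1 t‖ₑ ^ 2 ∂ν ≤ ∫⁻ _, 1 ∂ν := by
            refine lintegral_mono_ae ?_
            filter_upwards [hx, (hzb k).1] with t ht h
            rw [ht, ← enorm_neg, neg_sub]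
            refine pow_le_one₀ zero_le ?_
            rwa [← ofReal_norm, ENNReal.ofReal_le_one]
        _ = ν Set.univ := by simp
    · rw [zero_sub, enorm_neg, ← ofReal_norm, ENNReal.ofReal_le_one]
      exact (hzb k).2
  have hvalt : ∫⁻ t, G t x ∂ν + Ψ 0 + (∑' k, δ k) * (ν Set.univ + 1) ≠ ∞ :=
    ENNReal.add_ne_top.2 ⟨ENNReal.add_ne_top.2 ⟨hGfin, hΨ₀⟩,
      ENNReal.mul_ne_top hδ (ENNReal.add_ne_top.2 ⟨measure_ne_top _ _, ENNReal.one_ne_top⟩)⟩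
  have hwb := hball w (ne_top_of_le_ne_top hvalt (le_self_add.trans hval))
  -- Representatives are corrected on a null set so that the unit-ball bounds hold at every `t`.
  let rep : Lp X 2 ν → T → X := fun v t => if ‖v t - x‖ ≤ 1 then v t else x
  have hrepm : ∀ v, Measurable (rep v) := by
    intro v
    have hv : Measurable v := (Lp.stronglyMeasurable v).measurable
    exact hv.ite (measurableSet_le (by fun_prop) measurable_const) measurable_const
  have hrepb : ∀ v t, ‖rep v t - x‖ ≤ 1 := by
    intro v t
    simp only [rep]
    split_ifs with h
    · exact h
    · simp
  have hrep : ∀ v : Lp X 2 ν, (∀ᵐ t ∂ν, ‖v t - x‖ ≤ 1) → rep v =ᵐ[ν] v := by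
    intro v hv
    filter_upwards [hv] with t ht
    simp [rep, ht]
  have hJ : ∀ (v : Lp X 2 ν) (v' : T → X) (e : L), v' =ᵐ[ν] v →
      ∫⁻ t, (G t (v' t) + κ * ‖v' t - (x + e)‖ₑ ^ 2) ∂ν + Ψ e +
          ∑' k, δ k * (∫⁻ t, ‖v' t - rep (z k).1 t‖ₑ ^ 2 ∂ν + ‖e - (z k).2‖ₑ) =
        Φ (v, e) + ∑' k, δ k * ρ (v, e) (z k) := by
    intro v v' e hv
    congr 1
    · simp only [Φ]
      congr 1
      refine lintegral_congr_ae ?_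
      filter_upwards [hv] with t ht
      simp [H, ht]
    · refine tsum_congr fun k => ?_
      rw [hρ]
      congr 2
      refine lintegral_congr_ae ?_
      filter_upwards [hv, hrep _ (hzb k).1] with t ht h
      rw [ht, h]
  refine ⟨rep w.1, w.2, fun k => rep (z k).1, fun k => (z k).2, hrepm _, fun k => hrepm _,
    hrepb _, fun k => hrepb _, fun k => (hzb k).2, fun u' e' hu' => ?_, ?_⟩
  · rw [hJ w.1 _ w.2 (hrep _ hwb.1)]
    -- A competitor with infinite cost is harmless; any other lies almost everywhere in the unit
    -- ball around `x`, hence defines an element of `L²`.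
    by_cases hfin : ∫⁻ t, (G t (u' t) + κ * ‖u' t - (x + e')‖ₑ ^ 2) ∂ν = ∞
    · simp [hfin]
    have hm : Measurable fun t => G t (u' t) + κ * ‖u' t - (x + e')‖ₑ ^ 2 :=
      hHm.comp (measurable_id.prodMk (hu'.prodMk measurable_const))
    have hb : ∀ᵐ t ∂ν, ‖u' t‖ ≤ 1 + ‖x‖ := by
      filter_upwards [ae_lt_top hm hfin] with t ht
      have h1 := hGx t _ (ENNReal.add_ne_top.1 ht.ne).1
      have h2 := norm_le_norm_add_norm_sub x (u' t)
      rw [norm_sub_rev] at h2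
      linarith
    have hmem : MemLp u' 2 ν := MemLp.of_bound hu'.aestronglyMeasurable _ hb
    rw [hJ (hmem.toLp u') u' e' hmem.coeFn_toLp.symm]
    exact hw _
  · rw [hJ w.1 _ w.2 (hrep _ hwb.1)]
    exact hval

end JointMinimization

/-! ### Calculus of the quadratic penalty. -/

section PenalizedSubgradient

theorem ofReal_norm_sq {X : Type*} [NormedAddCommGroup X] (v : X) :
    ENNReal.ofReal (‖v‖ ^ 2) = ‖v‖ₑ ^ 2 := by
  rw [ENNReal.ofReal_pow (norm_nonneg _), ofReal_norm]

section Pointwise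

variable {X : Type*} [NormedAddCommGroup X] {d : ℕ → ℝ} {δ : ℝ} {x : X} {p : ℕ → X}

theorem summable_mul_norm_sub_sq (hd : ∀ k, 0 ≤ d k) (hs : HasSum d δ)
    (hp : ∀ k, ‖p k - x‖ ≤ 1) (v : X) : Summable fun k => d k * ‖v - p k‖ ^ 2 := by
  refine Summable.of_nonneg_of_le (fun k => mul_nonneg (hd k) (by positivity)) (fun k => ?_)
    (hs.summable.mul_right ((‖v - x‖ + 1) ^ 2))
  have h := norm_sub_le_norm_sub_add_norm_sub v x (p k)
  rw [norm_sub_rev x] at h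
  have := hp k
  exact mul_le_mul_of_nonneg_left (by gcongr; linarith) (hd k)

theorem ofReal_quadratic (hd : ∀ k, 0 ≤ d k) (hs : HasSum d δ)
    (hp : ∀ k, ‖p k - x‖ ≤ 1) {κ : ℝ} (hκ : 0 ≤ κ) (w v : X) :
    ENNReal.ofReal (κ * ‖v - w‖ ^ 2 + ∑' k, d k * ‖v - p k‖ ^ 2) =
      ENNReal.ofReal κ * ‖v - w‖ₑ ^ 2 + ∑' k, ENNReal.ofReal (d k) * ‖v - p k‖ₑ ^ 2 := by
  rw [ENNReal.ofReal_add (by positivity) (tsum_nonneg fun k => mul_nonneg (hd k) (by positivity)),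
    ENNReal.ofReal_mul hκ, ofReal_norm_sq,
    ENNReal.ofReal_tsum_of_nonneg (fun k => mul_nonneg (hd k) (by positivity))
      (summable_mul_norm_sub_sq hd hs hp v)]
  simp_rw [ENNReal.ofReal_mul (hd _), ofReal_norm_sq]

variable [NormedSpace ℝ X] {J : X → StrongDual ℝ X}

theorem hasFDerivAt_quadratic (hJ : ∀ v, HasFDerivAt (fun u : X => ‖u‖ ^ 2) (J v) v)
    (hJb : ∀ v, ‖J v‖ ≤ 2 * ‖v‖) (hd : ∀ k, 0 ≤ d k) (hs : HasSum d δ)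
    (hp : ∀ k, ‖p k - x‖ ≤ 1) (κ : ℝ) (w : X) {v : X} (hv : ‖v - x‖ ≤ 1) :
    HasFDerivAt (fun v => κ * ‖v - w‖ ^ 2 + ∑' k, d k * ‖v - p k‖ ^ 2)
      (κ • J (v - w) + ∑' k, d k • J (v - p k)) v := by
  have hsq : ∀ (a : X) (c : ℝ) (y : X),
      HasFDerivAt (fun v => c * ‖v - a‖ ^ 2) (c • J (y - a)) y := by
    intro a c y
    have h : HasFDerivAt (fun v : X => v - a) (ContinuousLinearMap.id ℝ X) y :=
      (hasFDerivAt_id y).sub_const a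
    simpa using ((hJ (y - a)).comp y h).const_mul c
  refine (hsq w κ v).add ?_
  have hmem : ∀ {y : X}, ‖y - x‖ ≤ 1 → y ∈ Metric.ball x 2 := fun {y} h => by
    rw [mem_ball_iff_norm]
    linarith
  -- On the ball of radius `2` one has `‖y - p k‖ ≤ 3`, so the termwise derivatives are bounded by
  -- `6 * d k`.
  refine hasFDerivAt_tsum_of_isPreconnected (u := fun k => d k * 6) (hs.summable.mul_right 6)
    Metric.isOpen_ball (convex_ball x 2).isPreconnected (fun k y _ => hsq (p k) (d k) y)
    (fun k y hy => ?_) (hmem hv) (summable_mul_norm_sub_sq hd hs hp v) (hmem hv)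
  rw [norm_smul, Real.norm_of_nonneg (hd k)]
  refine mul_le_mul_of_nonneg_left ((hJb _).trans ?_) (hd k)
  have h := norm_sub_le_norm_sub_add_norm_sub y x (p k)
  rw [norm_sub_rev x] at h
  have h1 := hp k
  have h2 := mem_ball_iff_norm.1 hy
  linarith

theorem summable_smul_fderiv (hJb : ∀ v, ‖J v‖ ≤ 2 * ‖v‖) (hd : ∀ k, 0 ≤ d k) (hs : HasSum d δ)
    (hp : ∀ k, ‖p k - x‖ ≤ 1) {v : X} (hv : ‖v - x‖ ≤ 1) :
    Summable (fun k => d k • J (v - p k)) ∧ ‖∑' k, d k • J (v - p k)‖ ≤ 4 * δ := by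
  have hb : ∀ k, ‖d k • J (v - p k)‖ ≤ 4 * d k := by
    intro k
    rw [norm_smul, Real.norm_of_nonneg (hd k), mul_comm]
    refine mul_le_mul_of_nonneg_right ((hJb _).trans ?_) (hd k)
    have h := norm_sub_le_norm_sub_add_norm_sub v x (p k)
    rw [norm_sub_rev x] at h
    have h1 := hp k
    linarith
  exact ⟨(hs.mul_left 4).summable.of_norm_bounded hb, tsum_of_norm_bounded (hs.mul_left 4) hb⟩

end Pointwise

variable {T X : Type*} [MeasurableSpace T] [NormedAddCommGroup X] [MeasurableSpace X]
  [BorelSpace X] [TopologicalSpace.SeparableSpace X]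

theorem integrable_norm_sub_sq (ν : Measure T) [IsFiniteMeasure ν] {u : T → X}
    (hu : Measurable u) {x : X} (hux : ∀ t, ‖u t - x‖ ≤ 1) (w : X) :
    Integrable (fun t => ‖u t - w‖ ^ 2) ν := by
  refine Integrable.of_bound (by fun_prop) ((1 + ‖x - w‖) ^ 2) (ae_of_all _ fun t => ?_)
  have h := norm_sub_le_norm_sub_add_norm_sub (u t) x w
  rw [Real.norm_of_nonneg (by positivity)]
  gcongr
  linarith [hux t]

theorem lintegral_norm_sub_sq (ν : Measure T) [IsFiniteMeasure ν] {u : T → X}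
    (hu : Measurable u) {x : X} (hux : ∀ t, ‖u t - x‖ ≤ 1) (w : X) :
    ∫⁻ t, ‖u t - w‖ₑ ^ 2 ∂ν = ENNReal.ofReal (∫ t, ‖u t - w‖ ^ 2 ∂ν) := by
  rw [ofReal_integral_eq_lintegral_ofReal (integrable_norm_sub_sq ν hu hux w)
    (ae_of_all _ fun t => by positivity)]
  simp_rw [ofReal_norm_sq]

variable [NormedSpace ℝ X]

theorem integrable_fderiv_norm_sq (ν : Measure T) [IsFiniteMeasure ν] {J : X → StrongDual ℝ X}
    (hJc : Continuous J) (hJb : ∀ v, ‖J v‖ ≤ 2 * ‖v‖) {u : T → X}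
    (hu : Measurable u) {x : X} (hux : ∀ t, ‖u t - x‖ ≤ 1) (w : X) :
    Integrable (fun t => J (u t - w)) ν := by
  have : SecondCountableTopology X := UniformSpace.secondCountable_of_separable X
  refine Integrable.of_bound
    (hJc.comp_stronglyMeasurable (hu.sub_const w).stronglyMeasurable).aestronglyMeasurable
    (2 * (1 + ‖x - w‖)) (ae_of_all _ fun t => (hJb _).trans ?_)
  have h := norm_sub_le_norm_sub_add_norm_sub (u t) x w
  linarith [hux t]

/-- Differentiation under the integral sign, with a constant bound because `u` is bounded and the
measure finite. It gives the derivative of the penalty in the common point. -/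
theorem hasFDerivAt_integral_norm_sub_sq (ν : Measure T) [IsFiniteMeasure ν]
    {J : X → StrongDual ℝ X} (hJ : ∀ v, HasFDerivAt (fun u : X => ‖u‖ ^ 2) (J v) v)
    (hJc : Continuous J) (hJb : ∀ v, ‖J v‖ ≤ 2 * ‖v‖) {u : T → X}
    (hu : Measurable u) {x : X} (hux : ∀ t, ‖u t - x‖ ≤ 1) (w : X) :
    HasFDerivAt (fun w => ∫ t, ‖u t - w‖ ^ 2 ∂ν) (-∫ t, J (u t - w) ∂ν) w := by
  rw [← integral_neg]
  refine hasFDerivAt_integral_of_dominated_of_fderiv_le (F' := fun w t => -J (u t - w))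
    (bound := fun _ => 2 * (2 + ‖x - w‖)) (Metric.ball_mem_nhds w one_pos)
    (Eventually.of_forall fun w => (integrable_norm_sub_sq ν hu hux w).aestronglyMeasurable)
    (integrable_norm_sub_sq ν hu hux w)
    (integrable_fderiv_norm_sq ν hJc hJb hu hux w).neg.aestronglyMeasurable
    (ae_of_all _ fun t y hy => ?_) (integrable_const _) (ae_of_all _ fun t y _ => ?_)
  · rw [norm_neg]
    refine (hJb _).trans ?_
    have h := norm_sub_le_norm_sub_add_norm_sub (u t) x y
    have h2 := norm_sub_le_norm_sub_add_norm_sub x w y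
    have h3 := mem_ball_iff_norm.1 hy
    rw [norm_sub_rev] at h3
    linarith [hux t]
  · have h : HasFDerivAt (fun y : X => u t - y) (-ContinuousLinearMap.id ℝ X) y :=
      (hasFDerivAt_id y).const_sub (u t)
    have := (hJ (u t - y)).comp y h
    simpa [Function.comp_def] using this

end PenalizedSubgradient

/-! ### Subgradients from the penalized problem. -/

section PenalizedStep

variable {T X : Type*} [MeasurableSpace T] [NormedAddCommGroup X] [NormedSpace ℝ X]
  [MeasurableSpace X] [BorelSpace X] [TopologicalSpace.SeparableSpace X]

/-- First-order condition in the finite-dimensional parameter. -/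
theorem abs_integral_fderiv_add_le (ν : Measure T) [IsFiniteMeasure ν]
    {L : Submodule ℝ X} {J : X → StrongDual ℝ X}
    (hJ : ∀ v, HasFDerivAt (fun u : X => ‖u‖ ^ 2) (J v) v)
    (hJc : Continuous J) (hJb : ∀ v, ‖J v‖ ≤ 2 * ‖v‖) {u : T → X}
    (hu : Measurable u) {x : X} (hux : ∀ t, ‖u t - x‖ ≤ 1) {x' : StrongDual ℝ X}
    {κ r ε δ : ℝ} {e : L} (he : ‖e‖ < r)
    (hmin : ∀ e' : L, ‖e'‖ ≤ r →
      κ * ∫ t, ‖u t - (x + e)‖ ^ 2 ∂ν - x' e + ε * ‖e‖ ≤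
        κ * ∫ t, ‖u t - (x + e')‖ ^ 2 ∂ν - x' e' + ε * ‖e'‖ + δ * ‖e' - e‖)
    (hε : 0 ≤ ε) (d : L) :
    |κ * (∫ t, J (u t - (x + e)) ∂ν) d + x' d| ≤ (ε + δ) * ‖d‖ := by
  have key : ∀ d : L, κ * (∫ t, J (u t - (x + e)) ∂ν) d + x' d ≤ (ε + δ) * ‖d‖ := by
    intro d
    -- Moving from `e` to `e + τ • d` changes the two norm terms by at most `τ * (ε + δ) * ‖d‖`;
    -- applying the result to `-d` gives the absolute value.
    have hA := (hasFDerivAt_integral_norm_sub_sq ν hJ hJc hJb hu hux (x + e)).const_mul κ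
    have h := hA.nonneg_of_eventually (d := (d : X)) (c := -x' d + (ε + δ) * ‖d‖) ?_
    · have hd : ‖(d : X)‖ = ‖d‖ := rfl
      simp only [smul_neg, neg_apply, smul_apply, smul_eq_mul] at h
      linarith
    · have hlt : ∀ᶠ τ in 𝓝 (0 : ℝ), ‖e + τ • d‖ < r := by
        have hc : Continuous fun τ : ℝ => ‖e + τ • d‖ := by fun_prop
        exact hc.continuousAt.eventually_lt continuousAt_const (by simpa using he)
      filter_upwards [hlt.filter_mono nhdsWithin_le_nhds, self_mem_nhdsWithin] with τ hτ hpos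
      have hτ₀ : (0 : ℝ) < τ := hpos
      have h1 := hmin (e + τ • d) hτ.le
      have h2 : ‖e + τ • d‖ ≤ ‖e‖ + τ * ‖d‖ := by
        refine (norm_add_le _ _).trans ?_
        rw [norm_smul, Real.norm_of_nonneg hτ₀.le]
      have h3 : ‖e + τ • d - e‖ = τ * ‖d‖ := by
        rw [add_sub_cancel_left, norm_smul, Real.norm_of_nonneg hτ₀.le]
      have h4 := mul_le_mul_of_nonneg_left h2 hε
      rw [h3] at h1
      simp only [Submodule.coe_add, Submodule.coe_smul, map_add, map_smul, smul_eq_mul,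
        ← add_assoc] at h1 ⊢
      nlinarith
  refine abs_le.2 ⟨?_, key d⟩
  have := key (-d)
  simp only [Submodule.coe_neg, map_neg, norm_neg] at this
  linarith

variable [CompleteSpace X]

/-- The penalized decoupled problem yields an approximate minimizer carrying pointwise
Fréchet subgradients whose integral is close to `x'` on the subspace `L`. -/
theorem exists_penalized_subgradient (ν : Measure T) [IsFiniteMeasure ν]
    (L : Submodule ℝ X) [FiniteDimensional ℝ L] (x : X) {J : X → StrongDual ℝ X}
    (hJ : ∀ v, HasFDerivAt (fun u : X => ‖u‖ ^ 2) (J v) v)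
    (hJc : Continuous J) (hJb : ∀ v, ‖J v‖ ≤ 2 * ‖v‖)
    {F : T → X → ℝ≥0∞} (hF : Measurable (Function.uncurry F))
    (hFl : ∀ t, LowerSemicontinuous (F t)) (hFx : ∀ᵐ t ∂ν, F t x ≤ 1) (x' : StrongDual ℝ X)
    {r ε κ δ : ℝ} (hr : 0 < r) (hr₁ : r ≤ 1) (hε : 0 ≤ ε) (hκ : 0 ≤ κ) (hδ : 0 < δ)
    (hδ₁ : δ ≤ 1) :
    ∃ (u : T → X) (e : L) (ξ : T → StrongDual ℝ X),
      Measurable u ∧ (∀ t, ‖u t - x‖ ≤ 1) ∧ ‖e‖ ≤ r ∧ AEStronglyMeasurable ξ ν ∧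
      (∀ t, ‖ξ t‖ ≤ 2 * κ * ‖u t - (x + e)‖ + 4 * δ) ∧
      (∀ᵐ t ∂ν, ‖u t - x‖ < 1 → IsFrechetSubgradient (F t) (u t) (ξ t)) ∧
      (∀ᵐ t ∂ν, κ * ‖u t - (x + e)‖ ^ 2 ≤ 1 + κ * ‖e‖ ^ 2 + δ) ∧
      (∫⁻ t, F t (u t) ∂ν + ENNReal.ofReal (κ * ∫ t, ‖u t - (x + e)‖ ^ 2 ∂ν) +
          ENNReal.ofReal (‖x'‖ * r - x' e + ε * ‖e‖) ≤
        ∫⁻ t, F t x ∂ν + ENNReal.ofReal (‖x'‖ * r) +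
          ENNReal.ofReal δ * (ν Set.univ + 1)) ∧
      (‖e‖ < r → ∀ d : L, |(∫ t, ξ t ∂ν) d - x' d| ≤ (ε + δ + 4 * δ * ν.real Set.univ) * ‖d‖) := by
  classical
  have : SecondCountableTopology X := UniformSpace.secondCountable_of_separable X
  -- Weights of total mass `δ`, so the whole perturbation is of order `δ`.
  let b : ℕ → ℝ := fun k => δ / 2 / 2 ^ k
  have hb : ∀ k, 0 < b k := fun k => by positivity
  have hbs : HasSum b δ := hasSum_geometric_two' δ
  have hbδ : ∀ k, b k ≤ δ := fun k => le_hasSum hbs k fun j _ => (hb j).le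
  have hbE : ∑' k, ENNReal.ofReal (b k) = ENNReal.ofReal δ := by
    rw [← ENNReal.ofReal_tsum_of_nonneg (fun k => (hb k).le) hbs.summable, hbs.tsum_eq]
  let G : T → X → ℝ≥0∞ := fun t v =>
    F t v + (Metric.closedBall x 1)ᶜ.indicator (fun _ => (∞ : ℝ≥0∞)) v
  have hGeq : ∀ t v, ‖v - x‖ ≤ 1 → G t v = F t v := by
    intro t v hv
    have : v ∉ (Metric.closedBall x 1)ᶜ := by simpa [dist_eq_norm] using hv
    simp only [G, Set.indicator_of_notMem this, add_zero]
  have hGx : ∀ t v, G t v ≠ ∞ → ‖v - x‖ ≤ 1 := by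
    intro t v h
    by_contra hv
    have : v ∈ (Metric.closedBall x 1)ᶜ := by simpa [dist_eq_norm] using hv
    simp [G, Set.indicator_of_mem this] at h
  have hGm : Measurable (Function.uncurry G) := by
    have h1 : Measurable fun q : T × X =>
        (Metric.closedBall x 1)ᶜ.indicator (fun _ => (∞ : ℝ≥0∞)) q.2 :=
      (measurable_const.indicator Metric.isClosed_closedBall.measurableSet.compl).comp
        measurable_snd
    exact hF.add h1
  have hGl : ∀ t, LowerSemicontinuous (G t) := fun t =>
    (hFl t).add (Metric.isClosed_closedBall.isOpen_compl.lowerSemicontinuous_indicator zero_le)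
  -- The constant `‖x'‖ * r` makes the objective nonnegative on the ball of radius `r`, as required
  -- in `ℝ≥0∞`.
  let ψ : L → ℝ := fun e => ‖x'‖ * r - x' e + ε * ‖e‖
  have hψ : ∀ e : L, ‖e‖ ≤ r → 0 ≤ ψ e := by
    intro e he
    have h1 : x' e ≤ ‖x'‖ * r := (le_abs_self _).trans
      ((x'.le_opNorm _).trans (mul_le_mul_of_nonneg_left he (norm_nonneg _)))
    have : 0 ≤ ε * ‖e‖ := by positivity
    simp only [ψ]
    linarith
  let Ψ : L → ℝ≥0∞ := fun e => ENNReal.ofReal (ψ e) +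
    (Metric.closedBall 0 r)ᶜ.indicator (fun _ => (∞ : ℝ≥0∞)) e
  have hΨeq : ∀ e, ‖e‖ ≤ r → Ψ e = ENNReal.ofReal (ψ e) := by
    intro e he
    have : e ∉ (Metric.closedBall 0 r)ᶜ := by simpa using he
    simp only [Ψ, Set.indicator_of_notMem this, add_zero]
  have hΨr : ∀ e, Ψ e ≠ ∞ → ‖e‖ ≤ r := by
    intro e h
    by_contra he
    have : e ∈ (Metric.closedBall 0 r)ᶜ := by simpa using he
    simp [Ψ, Set.indicator_of_mem this] at h
  have hΨl : LowerSemicontinuous Ψ := by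
    refine LowerSemicontinuous.add (Continuous.lowerSemicontinuous ?_)
      (Metric.isClosed_closedBall.isOpen_compl.lowerSemicontinuous_indicator zero_le)
    refine ENNReal.continuous_ofReal.comp ?_
    fun_prop
  have hΨ₀ : Ψ 0 = ENNReal.ofReal (‖x'‖ * r) := by
    rw [hΨeq 0 (by simpa using hr.le)]
    simp [ψ]
  have hGint : ∫⁻ t, G t x ∂ν = ∫⁻ t, F t x ∂ν :=
    lintegral_congr fun t => hGeq t x (by simp)
  have hFfin : ∫⁻ t, F t x ∂ν ≠ ∞ := by
    refine ne_top_of_le_ne_top (measure_ne_top ν Set.univ) ?_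
    calc ∫⁻ t, F t x ∂ν ≤ ∫⁻ _, 1 ∂ν := lintegral_mono_ae hFx
      _ = ν Set.univ := by simp
  obtain ⟨u, e, us, es, hu, hus, hub, husb, hesb, hmin, hval⟩ :=
    exists_joint_minimizer ν L x hGm hGl hGx (by rwa [hGint]) hΨl
      (by rw [hΨ₀]; exact ENNReal.ofReal_ne_top) (fun e h => (hΨr e h).trans hr₁)
      (κ := ENNReal.ofReal κ) ENNReal.ofReal_ne_top (δ := fun k => ENNReal.ofReal (b k))
      (fun k => by simpa using hb k) (fun k => by simpa using (hbδ k).trans hδ₁)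
      (by rw [hbE]; exact ENNReal.ofReal_ne_top)
  rw [hGint, hΨ₀, hbE] at hval
  have hvalt : ∫⁻ t, F t x ∂ν + ENNReal.ofReal (‖x'‖ * r) +
      ENNReal.ofReal δ * (ν Set.univ + 1) ≠ ∞ :=
    ENNReal.add_ne_top.2 ⟨ENNReal.add_ne_top.2 ⟨hFfin, ENNReal.ofReal_ne_top⟩,
      ENNReal.mul_ne_top ENNReal.ofReal_ne_top
        (ENNReal.add_ne_top.2 ⟨measure_ne_top _ _, ENNReal.one_ne_top⟩)⟩
  have hfin := ne_top_of_le_ne_top hvalt hval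
  obtain ⟨hfin₁, hfin₂⟩ := ENNReal.add_ne_top.1 hfin
  obtain ⟨hfin₃, hfin₄⟩ := ENNReal.add_ne_top.1 hfin₁
  have her : ‖e‖ ≤ r := hΨr e hfin₄
  have hGu : Measurable fun t => G t (u t) := hGm.comp (measurable_id.prodMk hu)
  have hsplit : ∀ e' : L, ∫⁻ t, (G t (u t) + ENNReal.ofReal κ * ‖u t - (x + e')‖ₑ ^ 2) ∂ν =
      ∫⁻ t, F t (u t) ∂ν + ENNReal.ofReal (κ * ∫ t, ‖u t - (x + e')‖ ^ 2 ∂ν) := by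
    intro e'
    rw [lintegral_add_left hGu, lintegral_const_mul _ (by fun_prop),
      lintegral_norm_sub_sq ν hu hub, ENNReal.ofReal_mul hκ]
    congr 1
    exact lintegral_congr fun t => hGeq t _ (hub t)
  have hFu : ∫⁻ t, F t (u t) ∂ν ≠ ∞ := by
    rw [hsplit e] at hfin₃
    exact (ENNReal.add_ne_top.1 hfin₃).1
  let ξ : T → StrongDual ℝ X := fun t =>
    -(κ • J (u t - (x + e)) + ∑' k, b k • J (u t - us k t))
  have hR : ∀ t, Summable (fun k => b k • J (u t - us k t)) ∧
      ‖∑' k, b k • J (u t - us k t)‖ ≤ 4 * δ := fun t =>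
    summable_smul_fderiv hJb (fun k => (hb k).le) hbs (fun k => husb k t) (hub t)
  have hRm : StronglyMeasurable fun t => ∑' k, b k • J (u t - us k t) := by
    refine stronglyMeasurable_of_tendsto atTop
      (f := fun n t => ∑ k ∈ Finset.range n, b k • J (u t - us k t)) (fun n => ?_)
      (tendsto_pi_nhds.2 fun t => (hR t).1.hasSum.tendsto_sum_nat)
    refine Finset.stronglyMeasurable_fun_sum _ fun k _ => ?_
    have h : StronglyMeasurable fun t => J (u t - us k t) :=
      hJc.comp_stronglyMeasurable (hu.sub (hus k)).stronglyMeasurable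
    exact h.const_smul (b k)
  have hRi : Integrable (fun t => ∑' k, b k • J (u t - us k t)) ν :=
    Integrable.of_bound hRm.aestronglyMeasurable (4 * δ) (ae_of_all _ fun t => (hR t).2)
  have hJi := integrable_fderiv_norm_sq ν hJc hJb hu hub (x + e)
  have hξi : Integrable ξ ν := ((hJi.smul κ).add hRi).neg
  let Q : T → X → ℝ≥0∞ := fun t v => G t v + (ENNReal.ofReal κ * ‖v - (x + e)‖ₑ ^ 2 +
    ∑' k, ENNReal.ofReal (b k) * ‖v - us k t‖ₑ ^ 2)
  have hQm : Measurable (Function.uncurry Q) := by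
    have h1 : Measurable fun q : T × X => ENNReal.ofReal κ * ‖q.2 - (x + e)‖ₑ ^ 2 := by fun_prop
    have h2 : Measurable fun q : T × X => ∑' k, ENNReal.ofReal (b k) * ‖q.2 - us k q.1‖ₑ ^ 2 := by
      refine Measurable.tsum fun k => ?_
      have := hus k
      fun_prop
    exact hGm.add (h1.add h2)
  have hQint : ∀ u' : T → X, Measurable u' → ∫⁻ t, Q t (u' t) ∂ν =
      ∫⁻ t, (G t (u' t) + ENNReal.ofReal κ * ‖u' t - (x + e)‖ₑ ^ 2) ∂ν +
        ∑' k, ENNReal.ofReal (b k) * ∫⁻ t, ‖u' t - us k t‖ₑ ^ 2 ∂ν := by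
    intro u' hu'
    simp only [Q, ← add_assoc]
    have hGu' : Measurable fun t => G t (u' t) := hGm.comp (measurable_id.prodMk hu')
    rw [lintegral_add_left (by fun_prop), lintegral_tsum fun k => by
      have := hus k
      fun_prop]
    congr 1
    refine tsum_congr fun k => ?_
    have := hus k
    rw [lintegral_const_mul _ (by fun_prop)]
  have hE : ∑' k, ENNReal.ofReal (b k) * ‖e - es k‖ₑ ≠ ∞ ∧
      ∑' k, ENNReal.ofReal (b k) * ∫⁻ t, ‖u t - us k t‖ₑ ^ 2 ∂ν ≠ ∞ := by
    have := hfin₂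
    simp only [mul_add] at this
    rw [ENNReal.tsum_add] at this
    exact (ENNReal.add_ne_top.1 this).symm
  -- Keeping `e` fixed and cancelling the finite terms that depend on `e` alone leaves an integral
  -- functional of `u`.
  have hpt : ∀ᵐ t ∂ν, ∀ v, Q t (u t) ≤ Q t v := by
    refine ae_forall_le_of_lintegral_le ν hQm hu ?_ fun u' hu' => ?_
    · rw [hQint u hu]
      exact ENNReal.add_ne_top.2 ⟨hfin₃, hE.2⟩
    · rw [hQint u hu, hQint u' hu']
      have h := hmin u' e hu'
      simp only [mul_add] at h
      rw [ENNReal.tsum_add, ENNReal.tsum_add] at h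
      refine (ENNReal.add_le_add_iff_left (ENNReal.add_ne_top.2 ⟨hfin₄, hE.1⟩)).1 ?_
      calc _ = _ := by ring
        _ ≤ _ := h
        _ = _ := by ring
  let q : T → X → ℝ := fun t v => κ * ‖v - (x + e)‖ ^ 2 + ∑' k, b k * ‖v - us k t‖ ^ 2
  have hq₀ : ∀ t v, 0 ≤ q t v := fun t v =>
    add_nonneg (by positivity) (tsum_nonneg fun k => mul_nonneg (hb k).le (by positivity))
  have hQq : ∀ t v, Q t v = G t v + ENNReal.ofReal (q t v) := fun t v => by
    simp only [Q, q]
    rw [ofReal_quadratic (fun k => (hb k).le) hbs (fun k => husb k t) hκ]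
  refine ⟨u, e, ξ, hu, hub, her, hξi.aestronglyMeasurable, fun t => ?_, ?_, ?_, ?_, fun her' d => ?_⟩
  · simp only [ξ, norm_neg]
    refine (norm_add_le _ _).trans (add_le_add ?_ (hR t).2)
    rw [norm_smul, Real.norm_of_nonneg hκ, mul_comm 2 κ, mul_assoc]
    exact mul_le_mul_of_nonneg_left (hJb _) hκ
  · filter_upwards [hpt, hFx] with t ht hFt hlt
    refine isFrechetSubgradient_neg_of_isLocalMin (q := q t) ?_
      (hasFDerivAt_quadratic hJ hJb (fun k => (hb k).le) hbs (fun k => husb k t) κ _ (hub t))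
      (hq₀ t) ?_
    · have h := ht x
      rw [hQq, hQq, hGeq t _ (hub t), hGeq t x (by simp)] at h
      exact ne_top_of_le_ne_top (ENNReal.add_ne_top.2
        ⟨ne_top_of_le_ne_top ENNReal.one_ne_top hFt, ENNReal.ofReal_ne_top⟩) (le_self_add.trans h)
    · have hnb : ∀ᶠ v in 𝓝 (u t), ‖v - x‖ < 1 := by
        have hc : Continuous fun v : X => ‖v - x‖ := by fun_prop
        exact hc.continuousAt.eventually_lt continuousAt_const hlt
      filter_upwards [hnb] with v hv
      have h := ht v
      rwa [hQq, hQq, hGeq t _ (hub t), hGeq t v hv.le] at h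
  -- Comparison with `v = x`; the normalization `F t x ≤ 1` makes the bound uniform in `t`, which is
  -- what gives `L^∞` convergence later.
  · filter_upwards [hpt, hFx] with t ht hFt
    have h := ht x
    rw [hQq, hQq, hGeq t _ (hub t), hGeq t x (by simp)] at h
    have h1 : ENNReal.ofReal (q t (u t)) ≤ ENNReal.ofReal (1 + q t x) := by
      rw [ENNReal.ofReal_add zero_le_one (hq₀ t x), ENNReal.ofReal_one]
      exact le_add_self.trans (h.trans (add_le_add_left hFt _))
    have h2 := (ENNReal.ofReal_le_ofReal_iff (add_nonneg zero_le_one (hq₀ t x))).1 h1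
    have h3 : q t x ≤ κ * ‖e‖ ^ 2 + δ := by
      simp only [q, sub_add_cancel_left, norm_neg]
      refine add_le_add le_rfl ?_
      refine ((summable_mul_norm_sub_sq (fun k => (hb k).le) hbs
        (fun k => husb k t) x).tsum_le_tsum (fun k => ?_) hbs.summable).trans_eq hbs.tsum_eq
      refine mul_le_of_le_one_right (hb k).le (pow_le_one₀ (norm_nonneg _) ?_)
      rw [norm_sub_rev]
      exact husb k t
    have h4 : κ * ‖u t - (x + e)‖ ^ 2 ≤ q t (u t) :=
      le_add_of_nonneg_right (tsum_nonneg fun k => mul_nonneg (hb k).le (by positivity))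
    linarith
  · rw [← hsplit e]
    refine le_trans ?_ hval
    rw [hΨeq e her]
    exact le_self_add
  -- Stationarity in `e` controls `-κ ∫ J - x'` on `L`; the remaining part of `∫ ξ` comes from the
  -- perturbation and costs `4 * δ` times the total mass.
  · have hfoc := abs_integral_fderiv_add_le ν hJ hJc hJb hu hub (x' := x') (κ := κ) (ε := ε)
      (δ := δ) her' (fun e' he' => ?_) hε d
    · have hint : (∫ t, ξ t ∂ν) = -(κ • ∫ t, J (u t - (x + e)) ∂ν) -
          ∫ t, ∑' k, b k • J (u t - us k t) ∂ν := by
        have h := integral_add (hJi.smul κ) hRi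
        simp only [Pi.smul_apply] at h
        simp only [ξ]
        rw [integral_neg, h, integral_smul, neg_add']
      have hRn : |(∫ t, ∑' k, b k • J (u t - us k t) ∂ν) d| ≤ 4 * δ * ν.real Set.univ * ‖d‖ := by
        rw [← Real.norm_eq_abs]
        refine (ContinuousLinearMap.le_opNorm _ _).trans ?_
        refine mul_le_mul_of_nonneg_right ?_ (norm_nonneg _)
        exact norm_integral_le_of_norm_le_const (ae_of_all _ fun t => (hR t).2)
      rw [hint]
      simp only [sub_apply, neg_apply, smul_apply, smul_eq_mul]
      have h1 := abs_le.1 hfoc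
      have h2 := abs_le.1 hRn
      rw [abs_le]
      constructor <;> nlinarith
    · have h := hmin u e' hu
      simp only [mul_add] at h
      rw [ENNReal.tsum_add, ENNReal.tsum_add, hsplit, hsplit, hΨeq e her, hΨeq e' he'] at h
      have hEe : ∑' k, ENNReal.ofReal (b k) * ‖e' - es k‖ₑ ≤
          ENNReal.ofReal (δ * ‖e' - e‖) + ∑' k, ENNReal.ofReal (b k) * ‖e - es k‖ₑ := by
        rw [ENNReal.ofReal_mul hδ.le, ← hbE, ← ENNReal.tsum_mul_right, ← ENNReal.tsum_add]
        refine ENNReal.tsum_le_tsum fun k => ?_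
        rw [← mul_add, ofReal_norm]
        refine mul_le_mul_right ?_ _
        simpa [edist_eq_enorm_sub] using edist_triangle e' e (es k)
      have h5 : ENNReal.ofReal (κ * ∫ t, ‖u t - (x + e)‖ ^ 2 ∂ν) + ENNReal.ofReal (ψ e) ≤
          ENNReal.ofReal (κ * ∫ t, ‖u t - (x + e')‖ ^ 2 ∂ν) + ENNReal.ofReal (ψ e') +
            ENNReal.ofReal (δ * ‖e' - e‖) := by
        refine (ENNReal.add_le_add_iff_left
          (ENNReal.add_ne_top.2 ⟨hFu, ENNReal.add_ne_top.2 ⟨hE.2, hE.1⟩⟩)).1 ?_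
        calc _ = _ := by ring
          _ ≤ _ := h
          _ ≤ _ := add_le_add le_rfl (add_le_add le_rfl hEe)
          _ = _ := by ring
      have hA : ∀ w : X, 0 ≤ κ * ∫ t, ‖u t - w‖ ^ 2 ∂ν := fun w =>
        mul_nonneg hκ (integral_nonneg fun t => by positivity)
      have hδe : 0 ≤ δ * ‖e' - e‖ := by positivity
      rw [← ENNReal.ofReal_add (hA _) (hψ e her), ← ENNReal.ofReal_add (hA _) (hψ e' he'),
        ← ENNReal.ofReal_add (add_nonneg (hA _) (hψ e' he')) hδe,
        ENNReal.ofReal_le_ofReal_iff (add_nonneg (add_nonneg (hA _) (hψ e' he')) hδe)] at h5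
      simp only [ψ] at h5
      linarith

end PenalizedStep

/-! ### The limit as the penalty grows. -/

section PenalizedLimit

variable {T X : Type*} [MeasurableSpace T] [NormedAddCommGroup X]
  [MeasurableSpace X]

theorem lintegral_le_liminf_of_ae_tendsto (ν : Measure T) {F : T → X → ℝ≥0∞}
    (hF : Measurable (Function.uncurry F)) (hFl : ∀ t, LowerSemicontinuous (F t))
    {u : ℕ → T → X} (hu : ∀ n, Measurable (u n)) {v : T → X}
    (huv : ∀ᵐ t ∂ν, Tendsto (fun n => u n t) atTop (𝓝 (v t))) :
    ∫⁻ t, F t (v t) ∂ν ≤ liminf (fun n => ∫⁻ t, F t (u n t) ∂ν) atTop := by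
  refine le_trans (lintegral_mono_ae ?_)
    (lintegral_liminf_le fun n => hF.comp (measurable_id.prodMk (hu n)))
  filter_upwards [huv] with t ht
  refine le_of_forall_lt fun a ha => ?_
  obtain ⟨b, hab, hb⟩ := exists_between ha
  exact hab.trans_le (le_liminf_of_le (by isBoundedDefault)
    ((ht.eventually (hFl t _ b hb)).mono fun n hn => hn.le))

/-- Lower semicontinuity sends the truncated difference to zero pointwise, and `F t x` dominates it.
This is the half of the `L¹` convergence that needs no information on values. -/
theorem tendsto_lintegral_tsub_of_ae_tendsto (ν : Measure T) {F : T → X → ℝ≥0∞}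
    (hF : Measurable (Function.uncurry F)) (hFl : ∀ t, LowerSemicontinuous (F t))
    {u : ℕ → T → X} (hu : ∀ n, Measurable (u n)) {x : X} (hFx : ∫⁻ t, F t x ∂ν ≠ ∞)
    (hux : ∀ᵐ t ∂ν, Tendsto (fun n => u n t) atTop (𝓝 x)) :
    Tendsto (fun n => ∫⁻ t, F t x - F t (u n t) ∂ν) atTop (𝓝 0) := by
  have hm : ∀ {v : T → X}, Measurable v → Measurable fun t => F t (v t) := fun hv =>
    hF.comp (measurable_id.prodMk hv)
  have hmx : Measurable fun t => F t x := hm measurable_const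
  have h := tendsto_lintegral_of_dominated_convergence (μ := ν) (fun t => F t x) (f := fun _ => 0)
    (F := fun n t => F t x - F t (u n t)) (fun n => hmx.sub (hm (hu n)))
    (fun n => ae_of_all _ fun t => tsub_le_self) hFx ?_
  · simpa using h
  filter_upwards [hux, ae_lt_top hmx hFx] with t ht hlt
  rw [ENNReal.tendsto_nhds_zero]
  intro η hη
  by_cases h0 : F t x = 0
  · simp [h0]
  have := ENNReal.sub_lt_self hlt.ne h0 hη.ne'
  filter_upwards [ht.eventually (hFl t x _ this)] with n hn
  rw [tsub_le_iff_right, add_comm]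
  exact tsub_le_iff_right.1 hn.le

variable [NormedSpace ℝ X] [CompleteSpace X]
  [BorelSpace X] [TopologicalSpace.SeparableSpace X]

/-- Approximate Fréchet subgradients of a nonnegative integrand on a finite measure space. -/
theorem exists_seq_isFrechetSubgradient (ν : Measure T) [IsFiniteMeasure ν]
    (L : Submodule ℝ X) [FiniteDimensional ℝ L] (x : X) {J : X → StrongDual ℝ X}
    (hJ : ∀ v, HasFDerivAt (fun u : X => ‖u‖ ^ 2) (J v) v)
    (hJc : Continuous J) (hJb : ∀ v, ‖J v‖ ≤ 2 * ‖v‖)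
    {F : T → X → ℝ≥0∞} (hF : Measurable (Function.uncurry F))
    (hFl : ∀ t, LowerSemicontinuous (F t)) (hFx : ∀ᵐ t ∂ν, F t x ≤ 1) (x' : StrongDual ℝ X)
    {r ε : ℝ} (hr : 0 < r) (hr₁ : r ≤ 1) (hε : 0 < ε)
    (hmin : ∀ e : L, ‖e‖ ≤ r →
      ENNReal.ofReal ((∫⁻ t, F t x ∂ν).toReal + x' e - ε * ‖e‖) ≤ ∫⁻ t, F t (x + e) ∂ν) :
    ∃ (u : ℕ → T → X) (e : ℕ → L) (ξ : ℕ → T → StrongDual ℝ X),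
      (∀ n, Measurable (u n)) ∧ (∀ n t, ‖u n t - x‖ ≤ 1) ∧
      (∀ n, AEStronglyMeasurable (ξ n) ν) ∧ (∀ n, ∃ C, ∀ t, ‖ξ n t‖ ≤ C) ∧
      (∀ᶠ n in atTop, ∀ᵐ t ∂ν, IsFrechetSubgradient (F t) (u n t) (ξ n t)) ∧
      Tendsto e atTop (𝓝 0) ∧
      (∃ c : ℕ → ℝ, Tendsto c atTop (𝓝 0) ∧ ∀ n, ∀ᵐ t ∂ν, ‖u n t - x‖ ≤ c n) ∧
      Tendsto (fun n => ∫ t, ‖ξ n t‖ * ‖u n t - (x + e n)‖ ∂ν) atTop (𝓝 0) ∧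
      Tendsto (fun n => ∫⁻ t, ((F t (u n t) - F t x) + (F t x - F t (u n t))) ∂ν) atTop (𝓝 0) ∧
      (∀ᶠ n in atTop, ∀ d : L, |(∫ t, ξ n t ∂ν) d - x' d| ≤ 3 * ε * ‖d‖) := by
  have : ProperSpace L := FiniteDimensional.proper ℝ L
  set A : ℝ := (∫⁻ t, F t x ∂ν).toReal with hA
  set V : ℝ := ν.real Set.univ with hV
  have hAfin : ∫⁻ t, F t x ∂ν ≠ ∞ := by
    refine ne_top_of_le_ne_top (measure_ne_top ν Set.univ) ?_
    calc ∫⁻ t, F t x ∂ν ≤ ∫⁻ _, 1 ∂ν := lintegral_mono_ae hFx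
      _ = ν Set.univ := by simp
  let κ : ℕ → ℝ := fun n => n + 1
  let δ : ℕ → ℝ := fun n => 1 / ((n : ℝ) + 1)
  have hκ : ∀ n, 0 < κ n := fun n => by positivity
  have hδ : ∀ n, 0 < δ n := fun n => by positivity
  have hδ₁ : ∀ n, δ n ≤ 1 := fun n => by
    simp only [δ]
    rw [div_le_one (by positivity)]
    linarith [(Nat.cast_nonneg n : (0 : ℝ) ≤ n)]
  have hδ₀ : Tendsto δ atTop (𝓝 0) := tendsto_one_div_add_atTop_nhds_zero_nat
  -- The penalty slope is `2 * ε`, twice the slope in `hmin`; the gap later forces `e` to tend to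
  -- `0`.
  choose u e ξ hu hub her hξm hξb hξs hsup hval hfoc using fun n =>
    exists_penalized_subgradient ν L x hJ hJc hJb hF hFl hFx x' hr hr₁
      (mul_pos two_pos hε).le (hκ n).le (hδ n) (hδ₁ n)
  let I : ℕ → ℝ := fun n => ∫ t, ‖u n t - (x + e n)‖ ^ 2 ∂ν
  have hI : ∀ n, 0 ≤ I n := fun n => integral_nonneg fun t => by positivity
  have hψ : ∀ n, 0 ≤ ‖x'‖ * r - x' (e n) + 2 * ε * ‖e n‖ := by
    intro n
    have h1 : x' (e n) ≤ ‖x'‖ * r := (le_abs_self _).trans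
      ((x'.le_opNorm _).trans (mul_le_mul_of_nonneg_left (her n) (norm_nonneg _)))
    have : 0 ≤ 2 * ε * ‖e n‖ := by positivity
    linarith
  have hFu : ∀ n, ∫⁻ t, F t (u n t) ∂ν ≠ ∞ ∧ (∫⁻ t, F t (u n t) ∂ν).toReal + κ n * I n
      - x' (e n) + 2 * ε * ‖e n‖ ≤ A + δ n * (V + 1) := by
    intro n
    have h := hval n
    have hC : 0 ≤ ‖x'‖ * r := by positivity
    have hV1 : ν Set.univ + 1 = ENNReal.ofReal (V + 1) := by
      rw [ENNReal.ofReal_add measureReal_nonneg zero_le_one, ENNReal.ofReal_one,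
        ofReal_measureReal]
    rw [hV1, ← ENNReal.ofReal_mul (hδ n).le] at h
    have hAC : ∫⁻ t, F t x ∂ν + ENNReal.ofReal (‖x'‖ * r) ≠ ∞ :=
      ENNReal.add_ne_top.2 ⟨hAfin, ENNReal.ofReal_ne_top⟩
    have hfin : ∫⁻ t, F t x ∂ν + ENNReal.ofReal (‖x'‖ * r) +
        ENNReal.ofReal (δ n * (V + 1)) ≠ ∞ :=
      ENNReal.add_ne_top.2 ⟨hAC, ENNReal.ofReal_ne_top⟩
    have hfu : ∫⁻ t, F t (u n t) ∂ν ≠ ∞ :=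
      ne_top_of_le_ne_top hfin ((le_self_add.trans le_self_add).trans h)
    refine ⟨hfu, ?_⟩
    have h2 := ENNReal.toReal_mono hfin h
    have hκI : 0 ≤ κ n * I n := mul_nonneg (hκ n).le (hI n)
    have hδV : 0 ≤ δ n * (V + 1) := mul_nonneg (hδ n).le (by positivity)
    rw [ENNReal.toReal_add (by simp [hfu]) ENNReal.ofReal_ne_top,
      ENNReal.toReal_add hfu ENNReal.ofReal_ne_top,
      ENNReal.toReal_add hAC ENNReal.ofReal_ne_top,
      ENNReal.toReal_add hAfin ENNReal.ofReal_ne_top,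
      ENNReal.toReal_ofReal hκI, ENNReal.toReal_ofReal (hψ n), ENNReal.toReal_ofReal hC,
      ENNReal.toReal_ofReal hδV] at h2
    linarith
  -- The penalized values stay bounded, so `I n` is of order `1 / κ n = δ n`.
  have hI₀ : Tendsto I atTop (𝓝 0) := by
    have hlim : Tendsto (fun n => (A + ‖x'‖ * r + (V + 1)) * δ n) atTop (𝓝 0) := by
      simpa using hδ₀.const_mul (A + ‖x'‖ * r + (V + 1))
    refine squeeze_zero hI (fun n => ?_) hlim
    have h1 := (hFu n).2
    have h2 := hψ n
    have h3 : (0 : ℝ) ≤ (∫⁻ t, F t (u n t) ∂ν).toReal := ENNReal.toReal_nonneg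
    have h4 : δ n * (V + 1) ≤ V + 1 := mul_le_of_le_one_left (by positivity) (hδ₁ n)
    simp only [δ]
    rw [mul_one_div, le_div_iff₀ (hκ n), mul_comm]
    simp only [κ] at h1
    linarith
  obtain ⟨e₀, he₀, φ, hφ, hφe⟩ := (isCompact_closedBall (0 : L) r).tendsto_subseq
    (x := e) fun n => by simpa using her n
  have hmeas : TendstoInMeasure ν (fun n t => ‖u (φ n) t - (x + e (φ n))‖ ^ 2) atTop
      (fun _ => (0 : ℝ)) := by
    refine tendstoInMeasure_of_tendsto_eLpNorm (p := 1) one_ne_zero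
      (fun n => (integrable_norm_sub_sq ν (hu _) (hub _) _).aestronglyMeasurable)
      aestronglyMeasurable_const ?_
    have h1 : ∀ n, eLpNorm ((fun t => ‖u (φ n) t - (x + e (φ n))‖ ^ 2) - fun _ => (0 : ℝ)) 1 ν =
        ENNReal.ofReal (I (φ n)) := by
      intro n
      rw [eLpNorm_one_eq_lintegral_enorm, ← lintegral_norm_sub_sq ν (hu _) (hub _)]
      simp
    simp_rw [h1]
    simpa using ENNReal.tendsto_ofReal (hI₀.comp hφ.tendsto_atTop)
  obtain ⟨χ, hχ, hae⟩ := hmeas.exists_seq_tendsto_ae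
  let m : ℕ → ℕ := φ ∘ χ
  have hm : Tendsto m atTop atTop := hφ.tendsto_atTop.comp hχ.tendsto_atTop
  have hme : Tendsto (fun n => e (m n)) atTop (𝓝 e₀) := hφe.comp hχ.tendsto_atTop
  have hmu : ∀ᵐ t ∂ν, Tendsto (fun n => u (m n) t) atTop (𝓝 (x + e₀)) := by
    filter_upwards [hae] with t ht
    have h1 : Tendsto (fun n => u (m n) t - (x + e (m n))) atTop (𝓝 0) := by
      rw [tendsto_zero_iff_norm_tendsto_zero]
      have := ht.sqrt
      simpa [Function.comp_def, m, Real.sqrt_sq (norm_nonneg _)] using this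
    have h2 : Tendsto (fun n => x + (e (m n) : X)) atTop (𝓝 (x + e₀)) :=
      ((continuous_subtype_val.tendsto e₀).comp hme).const_add x
    simpa using h1.add h2
  have hx'e : Tendsto (fun n => x' (e (m n))) atTop (𝓝 (x' e₀)) :=
    (x'.continuous.tendsto _).comp ((continuous_subtype_val.tendsto e₀).comp hme)
  have hδm : Tendsto (fun n => δ (m n) * (V + 1)) atTop (𝓝 0) := by
    simpa using (hδ₀.comp hm).mul_const (V + 1)
  have hrhs : Tendsto (fun n => A + δ (m n) * (V + 1) + x' (e (m n)) - 2 * ε * ‖e (m n)‖) atTop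
      (𝓝 (A + x' e₀ - 2 * ε * ‖e₀‖)) := by
    simpa using ((hδm.const_add A).add hx'e).sub (hme.norm.const_mul (2 * ε))
  have hale : ∀ n, (∫⁻ t, F t (u n t) ∂ν).toReal ≤
      A + δ n * (V + 1) + x' (e n) - 2 * ε * ‖e n‖ := by
    intro n
    have h1 := (hFu n).2
    have h2 := mul_nonneg (hκ n).le (hI n)
    linarith
  have he₀r : ‖e₀‖ ≤ r := by simpa using he₀
  -- Fatou bounds `∫ F t (x + e₀)` above with slope `2 * ε`, while `hmin` bounds it below with slope
  -- `ε`.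
  have hzero : e₀ = 0 := by
    have h1 : ENNReal.ofReal (A + x' e₀ - ε * ‖e₀‖) ≤
        ENNReal.ofReal (A + x' e₀ - 2 * ε * ‖e₀‖) := by
      refine (hmin e₀ he₀r).trans ((lintegral_le_liminf_of_ae_tendsto ν hF hFl
        (fun n => hu (m n)) hmu).trans ?_)
      rw [← (ENNReal.tendsto_ofReal hrhs).liminf_eq]
      refine liminf_le_liminf (Eventually.of_forall fun n => ?_)
      exact (ENNReal.le_ofReal_iff_toReal_le (hFu _).1
        (ENNReal.toReal_nonneg.trans (hale _))).2 (hale _)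
    have h2 : 0 ≤ A + x' e₀ - 2 * ε * ‖e₀‖ :=
      ge_of_tendsto' hrhs fun n => ENNReal.toReal_nonneg.trans (hale _)
    rw [ENNReal.ofReal_le_ofReal_iff h2] at h1
    have h3 : ε * ‖e₀‖ ≤ 0 := by linarith
    have h4 : ‖e₀‖ ≤ 0 := by
      by_contra! h
      exact absurd h3 (not_le.2 (mul_pos hε h))
    exact norm_le_zero_iff.1 h4
  subst hzero
  simp only [ZeroMemClass.coe_zero, add_zero, map_zero] at hmu hx'e
  have hFm : ∀ {v : T → X}, Measurable v → Measurable fun t => F t (v t) := fun hv =>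
    hF.comp (measurable_id.prodMk hv)
  have hFxm : Measurable fun t => F t x := hFm measurable_const
  let P : ℕ → ℝ≥0∞ := fun n => ∫⁻ t, F t x - F t (u (m n) t) ∂ν
  let Q : ℕ → ℝ≥0∞ := fun n => ∫⁻ t, F t (u (m n) t) - F t x ∂ν
  have hP : Tendsto P atTop (𝓝 0) :=
    tendsto_lintegral_tsub_of_ae_tendsto ν hF hFl (fun n => hu (m n)) hAfin hmu
  have hPQ : ∀ n, ∫⁻ t, F t (u (m n) t) ∂ν + P n = ∫⁻ t, F t x ∂ν + Q n := by
    intro n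
    simp only [P, Q]
    rw [← lintegral_add_left (hFm (hu _)), ← lintegral_add_left hFxm]
    exact lintegral_congr fun t => by rw [add_tsub_eq_max, add_tsub_eq_max, max_comm]
  have hPfin : ∀ n, P n ≠ ∞ := fun n =>
    ne_top_of_le_ne_top hAfin (lintegral_mono fun t => tsub_le_self)
  have hQfin : ∀ n, Q n ≠ ∞ := fun n =>
    ne_top_of_le_ne_top (hFu (m n)).1 (lintegral_mono fun t => tsub_le_self)
  have hPreal : Tendsto (fun n => (P n).toReal) atTop (𝓝 0) := by
    simpa [Function.comp_def] using (ENNReal.tendsto_toReal ENNReal.zero_ne_top).comp hP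
  have hbound : Tendsto (fun n => (P n).toReal + δ (m n) * (V + 1) + x' (e (m n))) atTop
      (𝓝 0) := by
    simpa using (hPreal.add hδm).add hx'e
  -- The negative part `P` already vanishes in the limit, so the value estimate controls both the
  -- positive part `Q` and the penalty `κ * I`.
  have hQI : ∀ n, (Q n).toReal + κ (m n) * I (m n) ≤
      (P n).toReal + δ (m n) * (V + 1) + x' (e (m n)) := by
    intro n
    have h1 := congrArg ENNReal.toReal (hPQ n)
    rw [ENNReal.toReal_add (hFu _).1 (hPfin n), ENNReal.toReal_add hAfin (hQfin n)] at h1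
    have h2 := (hFu (m n)).2
    have h3 : 0 ≤ 2 * ε * ‖e (m n)‖ := by positivity
    linarith
  have hκI : ∀ n, 0 ≤ κ (m n) * I (m n) := fun n => mul_nonneg (hκ _).le (hI _)
  have hQreal : Tendsto (fun n => (Q n).toReal) atTop (𝓝 0) :=
    squeeze_zero (fun n => ENNReal.toReal_nonneg) (fun n => by linarith [hQI n, hκI n]) hbound
  have hκI₀ : Tendsto (fun n => κ (m n) * I (m n)) atTop (𝓝 0) :=
    squeeze_zero hκI (fun n => by
      linarith [hQI n, (ENNReal.toReal_nonneg : (0 : ℝ) ≤ (Q n).toReal)]) hbound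
  have hQ : Tendsto Q atTop (𝓝 0) := by
    rw [← ENNReal.tendsto_toReal_iff hQfin ENNReal.zero_ne_top]
    simpa using hQreal
  have hme₀ : Tendsto (fun n => ‖e (m n)‖) atTop (𝓝 0) := by simpa using hme.norm
  -- Dividing the uniform estimate by `κ` gives `‖e‖² + (1 + δ) / κ`, and `(1 + δ) / κ ≤ 2 * δ`.
  let c : ℕ → ℝ := fun n => √(‖e (m n)‖ ^ 2 + 2 * δ (m n)) + ‖e (m n)‖
  have hc : Tendsto c atTop (𝓝 0) := by
    have h1 := ((hme₀.pow 2).add ((hδ₀.comp hm).const_mul 2)).sqrt.add hme₀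
    simpa [c] using h1
  have huc : ∀ n, ∀ᵐ t ∂ν, ‖u (m n) t - x‖ ≤ c n := by
    intro n
    filter_upwards [hsup (m n)] with t ht
    have h1 : ‖u (m n) t - (x + e (m n))‖ ^ 2 ≤ ‖e (m n)‖ ^ 2 + 2 * δ (m n) := by
      have h2 : κ (m n) * δ (m n) = 1 := mul_one_div_cancel (hκ _).ne'
      have h3 := hδ₁ (m n)
      refine le_of_mul_le_mul_left ?_ (hκ (m n))
      calc _ ≤ _ := ht
        _ ≤ κ (m n) * ‖e (m n)‖ ^ 2 + 2 * (κ (m n) * δ (m n)) := by rw [h2]; linarith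
        _ = _ := by ring
    have h2 : ‖u (m n) t - x‖ ≤ ‖u (m n) t - (x + e (m n))‖ + ‖e (m n)‖ := by
      have := norm_add_le (u (m n) t - (x + e (m n))) (e (m n) : X)
      rwa [show u (m n) t - (x + e (m n)) + (e (m n) : X) = u (m n) t - x by abel] at this
    exact h2.trans (add_le_add (Real.le_sqrt_of_sq_le h1) le_rfl)
  have huw : ∀ n t, ‖u n t - (x + e n)‖ ≤ 2 := by
    intro n t
    have h1 := norm_sub_le (u n t - x) (e n : X)
    rw [sub_sub] at h1
    have h2 : ‖(e n : X)‖ ≤ r := her n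
    linarith [hub n t]
  refine ⟨fun n => u (m n), fun n => e (m n), fun n => ξ (m n), fun n => hu _, fun n => hub _,
    fun n => hξm _, fun n => ⟨2 * κ (m n) * 2 + 4 * δ (m n), fun t => ?_⟩, ?_, hme, ⟨c, hc, huc⟩,
    ?_, ?_, ?_⟩
  · refine (hξb (m n) t).trans ?_
    have := huw (m n) t
    have := (hκ (m n)).le
    gcongr
  · filter_upwards [hc.eventually_lt_const one_pos] with n hn
    filter_upwards [hξs (m n), huc n] with t ht htc
    exact ht (htc.trans_lt hn)
  · have hlim : Tendsto (fun n => 2 * (κ (m n) * I (m n)) + 8 * V * δ (m n)) atTop (𝓝 0) := by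
      simpa using (hκI₀.const_mul 2).add ((hδ₀.comp hm).const_mul (8 * V))
    refine squeeze_zero (fun n => integral_nonneg fun t => by positivity) (fun n => ?_) hlim
    have hi := integrable_norm_sub_sq ν (hu (m n)) (hub (m n)) (x + e (m n))
    calc ∫ t, ‖ξ (m n) t‖ * ‖u (m n) t - (x + e (m n))‖ ∂ν
        ≤ ∫ t, (2 * κ (m n) * ‖u (m n) t - (x + e (m n))‖ ^ 2 + 8 * δ (m n)) ∂ν := by
          refine integral_mono_of_nonneg (ae_of_all _ fun t => by positivity)
            ((hi.const_mul _).add (integrable_const _)) (ae_of_all _ fun t => ?_)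
          have h1 := mul_le_mul_of_nonneg_right (hξb (m n) t)
            (norm_nonneg (u (m n) t - (x + e (m n))))
          have h2 := mul_le_mul_of_nonneg_left (huw (m n) t) (hδ (m n)).le
          refine h1.trans ?_
          nlinarith
      _ = 2 * (κ (m n) * I (m n)) + 8 * V * δ (m n) := by
          rw [integral_add (hi.const_mul _) (integrable_const _), integral_const_mul,
            integral_const, smul_eq_mul]
          simp only [I, V]
          ring
  · have h := hQ.add hP
    rw [add_zero] at h
    refine h.congr fun n => ?_
    exact (lintegral_add_left ((hFm (hu _)).sub hFxm) _).symm
  · have hlim : Tendsto (fun n => δ (m n) + 4 * δ (m n) * V) atTop (𝓝 0) := by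
      have h := hδ₀.comp hm
      simpa using h.add ((h.const_mul 4).mul_const V)
    -- The bound `3 * ε` is the slope `2 * ε` plus perturbation terms that are eventually at most
    -- `ε`. Stationarity requires `e` in the open ball.
    filter_upwards [hme₀.eventually_lt_const hr, hlim.eventually_le_const hε] with n h1 h2 d
    refine (hfoc (m n) h1 d).trans ?_
    exact mul_le_mul_of_nonneg_right (by linarith) (norm_nonneg _)

end PenalizedLimit

/-! ### Passage between the quotient and `ε`-forms of the subdifferential; sum rule. -/

section FrechetSubdifferential

theorem EReal.neg_le_sub_sub_div_iff {Φ : EReal} {a b n η : ℝ} (hn : 0 < n) :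
    ((-η : ℝ) : EReal) ≤ (Φ - a - b) / n ↔ ((a + b - η * n : ℝ) : EReal) ≤ Φ := by
  induction Φ with
  | bot => simp [EReal.bot_div_of_pos_ne_top (EReal.coe_pos.2 hn) (EReal.coe_ne_top n),
      -EReal.coe_neg, -EReal.coe_add, -EReal.coe_sub, -EReal.coe_mul]
  | coe φ =>
    rw [← EReal.coe_sub, ← EReal.coe_sub, ← EReal.coe_div, EReal.coe_le_coe_iff,
      EReal.coe_le_coe_iff, le_div_iff₀ hn]
    constructor <;> intro h <;> linarith
  | top => simp [EReal.top_div_of_pos_ne_top (EReal.coe_pos.2 hn) (EReal.coe_ne_top n)]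

variable {X : Type*} [NormedAddCommGroup X] [NormedSpace ℝ X]

/-- The Fréchet subdifferential in `ε`-form. -/
theorem mem_frechetSubdifferential_iff {φ : X → EReal} {x : X} {x' : StrongDual ℝ X} :
    x' ∈ frechetSubdifferential φ x ↔ φ x ≠ ⊤ ∧ φ x ≠ ⊥ ∧ ∀ η > 0, ∀ᶠ v in 𝓝 x,
      (((φ x).toReal + x' (v - x) - η * ‖v - x‖ : ℝ) : EReal) ≤ φ v := by
  refine and_congr_right fun htop => and_congr_right fun hbot => ?_
  have hφ : φ x = ((φ x).toReal : EReal) := (EReal.coe_toReal htop hbot).symm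
  have key : ∀ η : ℝ, (∀ᶠ v in 𝓝 x,
      (((φ x).toReal + x' (v - x) - η * ‖v - x‖ : ℝ) : EReal) ≤ φ v) ↔
      ∀ᶠ h in 𝓝[≠] (0 : X), ((-η : ℝ) : EReal) ≤
        (φ (x + h) - φ x - ((x' h : ℝ) : EReal)) / ((‖h‖ : ℝ) : EReal) := by
    intro η
    rw [← map_add_left_nhds_zero, eventually_map, eventually_nhdsWithin_iff]
    refine eventually_congr (Eventually.of_forall fun h => ?_)
    -- The punctured neighbourhood may be filled in, as the `ε`-inequality is an equality at the
    -- base point.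
    by_cases h0 : h = 0
    · subst h0
      simp [← hφ]
    · have hn : 0 < ‖h‖ := norm_pos_iff.2 h0
      simp only [Set.mem_compl_iff, Set.mem_singleton_iff, h0, not_false_eq_true, true_imp_iff,
        add_sub_cancel_left]
      rw [← EReal.neg_le_sub_sub_div_iff hn, ← hφ]
  simp_rw [key]
  constructor
  · intro h η hη
    have hlt : ((-η : ℝ) : EReal) < 0 := by exact_mod_cast neg_lt_zero.2 hη
    exact (eventually_lt_of_lt_liminf (hlt.trans_le h)).mono fun _ hv => hv.le
  · intro h
    refine le_of_forall_lt fun a ha => ?_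
    obtain ⟨b, hab, hb⟩ := EReal.lt_iff_exists_real_btwn.1 ha
    have hb' : b < 0 := by exact_mod_cast hb
    refine hab.trans_le (le_liminf_of_le (by isBoundedDefault) ?_)
    simpa using h (-b) (neg_pos.2 hb')

theorem IsFrechetSubgradient.const_mul {F : X → ℝ≥0∞} {u : X} {ξ : StrongDual ℝ X}
    (h : IsFrechetSubgradient F u ξ) {c : NNReal} (hc : c ≠ 0) :
    IsFrechetSubgradient (fun v => c * F v) u (c • ξ) := by
  refine ⟨ENNReal.mul_ne_top ENNReal.coe_ne_top h.1, fun η hη => ?_⟩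
  have hc' : (0 : ℝ) < c := by positivity
  filter_upwards [h.2 (η / c) (by positivity)] with v hv
  have h1 : (c : ℝ) * ((F u).toReal + ξ (v - u) - η / c * ‖v - u‖) =
      (c * F u).toReal + (c • ξ) (v - u) - η * ‖v - u‖ := by
    rw [ENNReal.toReal_mul, ENNReal.coe_toReal]
    change _ = c * (F u).toReal + c * ξ (v - u) - η * ‖v - u‖
    field_simp
  rw [← h1, ENNReal.ofReal_mul hc'.le, ENNReal.ofReal_coe_nnreal]
  exact mul_le_mul_right hv _

/-- Sum rule for a nonnegative function and a differentiable function. -/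
theorem IsFrechetSubgradient.add_mem_frechetSubdifferential {F : X → ℝ≥0∞} {u : X}
    {ξ : StrongDual ℝ X} (h : IsFrechetSubgradient F u ξ) {φ : X → EReal}
    {g : X → ℝ} {g' : StrongDual ℝ X} (hg : HasFDerivAt g g' u)
    (hφ : ∀ v, φ v = (F v : EReal) + (g v : EReal)) :
    ξ + g' ∈ frechetSubdifferential φ u := by
  have hreal : ∀ v, F v ≠ ∞ → φ v = (((F v).toReal + g v : ℝ) : EReal) := by
    intro v hv
    rw [hφ, EReal.coe_add, EReal.coe_ennreal_toReal hv]
  have hu := hreal u h.1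
  rw [mem_frechetSubdifferential_iff]
  refine ⟨by rw [hu]; exact EReal.coe_ne_top _, by rw [hu]; exact EReal.coe_ne_bot _,
    fun η hη => ?_⟩
  filter_upwards [h.2 (η / 2) (half_pos hη), hg.isLittleO.def (half_pos hη)] with v hv hgv
  by_cases hFv : F v = ∞
  · simp [hφ, hFv]
  rw [hreal v hFv, hu, EReal.toReal_coe, EReal.coe_le_coe_iff]
  have h1 := (ENNReal.ofReal_le_iff_le_toReal hFv).1 hv
  have h2 := (abs_le.1 (Real.norm_eq_abs _ ▸ hgv)).1
  rw [add_apply]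
  linarith

end FrechetSubdifferential

/-! ### Weak-* continuous seminorms. -/

section WeakStarSeminorm

/-- A weak-* continuous seminorm is controlled by the values on a finite-dimensional subspace. -/
theorem Seminorm.exists_finiteDimensional_bound {X : Type*} [NormedAddCommGroup X]
    [NormedSpace ℝ X] (ρ : Seminorm ℝ (WeakDual ℝ X)) (hρ : Continuous ρ) :
    ∃ (L : Submodule ℝ X) (C : ℝ), FiniteDimensional ℝ L ∧ 0 ≤ C ∧
      ∀ (φ : StrongDual ℝ X) (c : ℝ), 0 ≤ c → (∀ d : L, |φ d| ≤ c * ‖d‖) →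
        ρ (StrongDual.toWeakDual φ) ≤ C * c := by
  obtain ⟨s, C, -, h⟩ := Seminorm.bound_of_continuous
    (LinearMap.weakBilin_withSeminorms (topDualPairing ℝ X)) ρ hρ
  -- The seminorm is dominated by finitely many evaluations; `L` is the span of the evaluation
  -- points.
  refine ⟨Submodule.span ℝ (s : Set X), C * ∑ e ∈ s, ‖e‖, inferInstance, by positivity,
    fun φ c hc hφ => ?_⟩
  have h0 : ρ (StrongDual.toWeakDual φ) ≤ C * (s.sup (topDualPairing ℝ X).toSeminormFamily)
    (StrongDual.toWeakDual φ) := h (StrongDual.toWeakDual φ)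
  refine h0.trans ?_
  rw [mul_assoc]
  refine mul_le_mul_of_nonneg_left ?_ C.2
  refine Seminorm.finset_sup_apply_le (by positivity) fun e he => ?_
  have h1 := hφ ⟨e, Submodule.subset_span he⟩
  calc _ = |φ e| := rfl
    _ ≤ c * ‖e‖ := h1
    _ ≤ c * ∑ e ∈ s, ‖e‖ := by
        gcongr
        exact Finset.single_le_sum (f := fun e => ‖e‖) (fun _ _ => norm_nonneg _) he
    _ = _ := mul_comm _ _

end WeakStarSeminorm

/-! ### Measurability of gradients. -/

section Measurability

/-- Separability of `X` expresses preimages of closed dual balls by countably many evaluations, and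
separability of the dual writes each open set as a countable union of such balls. -/
theorem stronglyMeasurable_of_measurable_apply {T X : Type*} [MeasurableSpace T]
    [NormedAddCommGroup X] [NormedSpace ℝ X] [TopologicalSpace.SeparableSpace X]
    [TopologicalSpace.SeparableSpace (StrongDual ℝ X)] {D : T → StrongDual ℝ X}
    (hD : ∀ v, Measurable fun t => D t v) : StronglyMeasurable D := by
  borelize (StrongDual ℝ X)
  have : SecondCountableTopology (StrongDual ℝ X) :=
    UniformSpace.secondCountable_of_separable _
  refine Measurable.stronglyMeasurable ?_
  have hdist : ∀ c : StrongDual ℝ X, ∀ r : ℝ, 0 ≤ r → MeasurableSet {t | ‖D t - c‖ ≤ r} := by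
    intro c r hr
    have : {t | ‖D t - c‖ ≤ r} = ⋂ n, {t | |D t (TopologicalSpace.denseSeq X n) -
        c (TopologicalSpace.denseSeq X n)| ≤ r * ‖TopologicalSpace.denseSeq X n‖} := by
      ext t
      simp only [Set.mem_iInter]
      constructor
      · intro h n
        exact ((D t - c).le_opNorm _).trans (mul_le_mul_of_nonneg_right h (norm_nonneg _))
      · intro h
        refine ContinuousLinearMap.opNorm_le_bound _ hr fun v => ?_
        refine (TopologicalSpace.denseRange_denseSeq X).induction_on v ?_ h
        exact isClosed_le (by fun_prop) (by fun_prop)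
    rw [this]
    exact MeasurableSet.iInter fun n =>
      measurableSet_le ((hD _).sub_const _).abs measurable_const
  refine measurable_of_isOpen fun U hU => ?_
  let s := TopologicalSpace.denseSeq (StrongDual ℝ X)
  have hUeq : D ⁻¹' U = ⋃ n, ⋃ k : ℕ, ⋃ _ : Metric.closedBall (s n) (1 / (k + 1)) ⊆ U,
      {t | ‖D t - s n‖ ≤ 1 / ((k : ℝ) + 1)} := by
    ext t
    simp only [Set.mem_iUnion, Set.mem_preimage]
    constructor
    · intro ht
      obtain ⟨δ, hδ, hball⟩ := Metric.isOpen_iff.1 hU _ ht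
      obtain ⟨k, hk⟩ := exists_nat_one_div_lt (half_pos hδ)
      have hk0 : (0 : ℝ) < 1 / (k + 1) := by positivity
      obtain ⟨n, hn⟩ := (TopologicalSpace.denseRange_denseSeq (StrongDual ℝ X)).exists_dist_lt
        (D t) hk0
      refine ⟨n, k, fun y hy => hball ?_, ?_⟩
      · have h1 := dist_triangle y (s n) (D t)
        have h2 := Metric.mem_closedBall.1 hy
        rw [dist_comm (s n)] at h1
        rw [Metric.mem_ball]
        have : dist (D t) (s n) < 1 / (k + 1) := hn
        linarith
      · change ‖D t - s n‖ ≤ _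
        rw [← dist_eq_norm]
        exact hn.le
    · rintro ⟨n, k, hU', ht⟩
      refine hU' ?_
      rw [Metric.mem_closedBall, dist_eq_norm]
      exact ht
  rw [hUeq]
  exact MeasurableSet.iUnion fun n => MeasurableSet.iUnion fun k => MeasurableSet.iUnion fun _ =>
    hdist _ _ (by positivity)

variable {T X : Type*} [MeasurableSpace T] [NormedAddCommGroup X] [NormedSpace ℝ X]
  [MeasurableSpace X] [BorelSpace X] [TopologicalSpace.SeparableSpace X]
  [TopologicalSpace.SeparableSpace (StrongDual ℝ X)]

theorem stronglyMeasurable_fderiv_comp {g : T → X → ℝ} (hg : Measurable (Function.uncurry g))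
    (hgd : ∀ t, Differentiable ℝ (g t)) {u : T → X} (hu : Measurable u) :
    StronglyMeasurable fun t => fderiv ℝ (g t) (u t) := by
  have : SecondCountableTopology X := UniformSpace.secondCountable_of_separable X
  refine stronglyMeasurable_of_measurable_apply fun v => ?_
  refine measurable_of_tendsto_metrizable
    (f := fun (n : ℕ) t => ((n : ℝ) + 1) * (g t (u t + ((n : ℝ) + 1)⁻¹ • v) - g t (u t)))
    (fun n => ?_) (tendsto_pi_nhds.2 fun t => ?_)
  · have h1 : Measurable fun t => g t (u t + ((n : ℝ) + 1)⁻¹ • v) :=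
      hg.comp (measurable_id.prodMk (hu.add_const _))
    have h2 : Measurable fun t => g t (u t) := hg.comp (measurable_id.prodMk hu)
    exact (h1.sub h2).const_mul _
  · have h := ((hgd t) (u t)).hasFDerivAt.lim v (α := ℕ) (l := atTop)
      (c := fun n => (n : ℝ) + 1) ?_
    · simpa using h
    · have := tendsto_natCast_atTop_atTop (R := ℝ)
      exact tendsto_norm_atTop_atTop.comp (tendsto_atTop_add_const_right _ _ this)

theorem measurable_iSup_enorm_fderiv {g : T → X → ℝ} (hg : Measurable (Function.uncurry g))
    (hgd : ∀ t, ContDiff ℝ 1 (g t)) : Measurable fun t => ⨆ u : X, ‖fderiv ℝ (g t) u‖ₑ := by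
  have : (fun t => ⨆ u : X, ‖fderiv ℝ (g t) u‖ₑ) =
      fun t => ⨆ n, ‖fderiv ℝ (g t) (TopologicalSpace.denseSeq X n)‖ₑ := by
    funext t
    refine le_antisymm (iSup_le fun u => ?_) (iSup_le fun n => le_iSup (fun u => ‖fderiv ℝ (g t) u‖ₑ) _)
    refine (TopologicalSpace.denseRange_denseSeq X).induction_on u ?_
      (fun n => le_iSup (fun n => ‖fderiv ℝ (g t) (TopologicalSpace.denseSeq X n)‖ₑ) n)
    exact isClosed_le ((hgd t).continuous_fderiv one_ne_zero).enorm continuous_const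
  rw [this]
  exact Measurable.iSup fun n => (stronglyMeasurable_fderiv_comp hg
    (fun t => (hgd t).differentiable one_ne_zero) measurable_const).enorm

end Measurability

/-! ### Removing the smooth minorant; from finite to `σ`-finite measures. -/

section Reduction

theorem coe_toENNReal_sub_add {a : EReal} {b : ℝ} (h : (b : EReal) ≤ a) :
    ((a - b).toENNReal : EReal) + b = a := by
  induction a with
  | bot => simp at h
  | coe a =>
    have h' : b ≤ a := by exact_mod_cast h
    rw [← EReal.coe_sub, EReal.coe_toENNReal (by exact_mod_cast sub_nonneg.2 h'), ← EReal.coe_add,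
      sub_add_cancel]
  | top => simp

theorem ereal_abs_sub_le_tsub_add_tsub {P Q : ℝ≥0∞} (hP : P ≠ ∞) (hQ : Q ≠ ∞) (a b : ℝ) :
    (((P : EReal) + a) - ((Q : EReal) + b)).abs ≤ ((P - Q) + (Q - P)) + ‖a - b‖ₑ := by
  lift P to NNReal using hP
  lift Q to NNReal using hQ
  have h1 : (((P : ℝ≥0∞) : EReal) + a) - (((Q : ℝ≥0∞) : EReal) + b) =
      (((P : ℝ) + a - (Q + b) : ℝ) : EReal) := by
    simp [EReal.coe_nnreal_eq_coe_real]
  have h2 : ((P : ℝ≥0∞) - Q) + (Q - P) = ENNReal.ofReal |(P : ℝ) - Q| := by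
    rcases le_total P Q with h | h
    · rw [tsub_eq_zero_of_le (by exact_mod_cast h), zero_add, abs_sub_comm,
        abs_of_nonneg (sub_nonneg.2 (by exact_mod_cast h)), ENNReal.ofReal_sub _ P.coe_nonneg]
      simp
    · rw [tsub_eq_zero_of_le (a := (Q : ℝ≥0∞)) (by exact_mod_cast h), add_zero,
        abs_of_nonneg (sub_nonneg.2 (by exact_mod_cast h)), ENNReal.ofReal_sub _ Q.coe_nonneg]
      simp
  rw [h1, h2, EReal.abs_def, ← ofReal_norm, Real.norm_eq_abs,
    ← ENNReal.ofReal_add (abs_nonneg _) (abs_nonneg _)]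
  refine ENNReal.ofReal_le_ofReal ?_
  have := abs_add_le ((P : ℝ) - Q) (a - b)
  rwa [show (P : ℝ) - Q + (a - b) = P + a - (Q + b) by ring] at this

/-- Integrating `φ⁺ + b⁻ = (φ - b) + (b⁺ + φ⁻)` avoids subtraction. The minorant makes `∫ φ⁻`
finite, so the convention for `∞ - ∞` never intervenes. -/
theorem extendedIntegral_eq_add {T : Type*} [MeasurableSpace T] {μ : Measure T} {φ : T → EReal}
    (hφ : Measurable φ) {b : T → ℝ} (hbm : Measurable b) (hb : Integrable b μ)
    (h : ∀ t, (b t : EReal) ≤ φ t) :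
    extendedIntegral μ φ =
      ((∫⁻ t, (φ t - b t).toENNReal ∂μ : ℝ≥0∞) : EReal) + ((∫ t, b t ∂μ : ℝ) : EReal) := by
  have hpt : ∀ t, (φ t).toENNReal + ENNReal.ofReal (-b t) =
      (φ t - b t).toENNReal + (ENNReal.ofReal (b t) + (-φ t).toENNReal) := by
    intro t
    have ht := h t
    generalize φ t = a at ht ⊢
    induction a with
    | bot => simp at ht
    | coe a =>
      have h' : b t ≤ a := by exact_mod_cast ht
      rw [← EReal.coe_sub, ← EReal.coe_neg, EReal.real_coe_toENNReal, EReal.real_coe_toENNReal,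
        EReal.real_coe_toENNReal]
      rw [← ENNReal.toReal_eq_toReal_iff' (by simp) (by simp), ENNReal.toReal_add (by simp)
        (by simp), ENNReal.toReal_add (by simp) (by simp), ENNReal.toReal_add (by simp) (by simp)]
      simp only [ENNReal.toReal_ofReal']
      rw [max_eq_left (sub_nonneg.2 h')]
      rcases le_total a 0 with h1 | h1 <;> rcases le_total (b t) 0 with h2 | h2 <;>
        simp [h1, h2] <;> linarith
    | top => simp
  have hsum : ∫⁻ t, (φ t).toENNReal ∂μ + ∫⁻ t, ENNReal.ofReal (-b t) ∂μ =
      ∫⁻ t, (φ t - b t).toENNReal ∂μ +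
        (∫⁻ t, ENNReal.ofReal (b t) ∂μ + ∫⁻ t, (-φ t).toENNReal ∂μ) := by
    have h1 : Measurable fun t => (-φ t).toENNReal :=
      (continuous_neg.measurable.comp hφ).ereal_toENNReal
    have h2 : Measurable fun t => ENNReal.ofReal (b t) + (-φ t).toENNReal :=
      hbm.ennreal_ofReal.add h1
    rw [← lintegral_add_left hφ.ereal_toENNReal, ← lintegral_add_left hbm.ennreal_ofReal,
      ← lintegral_add_right _ h2]
    exact lintegral_congr hpt
  have hpos : ∫⁻ t, ENNReal.ofReal (b t) ∂μ ≠ ∞ := hb.lintegral_lt_top.ne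
  have hneg : ∫⁻ t, ENNReal.ofReal (-b t) ∂μ ≠ ∞ := hb.neg.lintegral_lt_top.ne
  have hN : ∫⁻ t, (-φ t).toENNReal ∂μ ≠ ∞ := by
    refine ne_top_of_le_ne_top hneg (lintegral_mono fun t => ?_)
    rw [← EReal.real_coe_toENNReal, EReal.coe_neg]
    exact EReal.toENNReal_le_toENNReal (EReal.neg_le_neg_iff.2 (h t))
  rw [extendedIntegral, integral_eq_lintegral_pos_part_sub_lintegral_neg_part hb]
  generalize ∫⁻ t, (φ t).toENNReal ∂μ = P at *
  generalize ∫⁻ t, (φ t - b t).toENNReal ∂μ = F at *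
  generalize ∫⁻ t, (-φ t).toENNReal ∂μ = N at *
  generalize ∫⁻ t, ENNReal.ofReal (b t) ∂μ = B at *
  generalize ∫⁻ t, ENNReal.ofReal (-b t) ∂μ = B' at *
  split_ifs with hP
  · have hF : F = ∞ := by
      by_contra hF
      rw [hP, top_add] at hsum
      exact (ENNReal.add_ne_top.2 ⟨hF, ENNReal.add_ne_top.2 ⟨hpos, hN⟩⟩) hsum.symm
    rw [hF, EReal.coe_ennreal_top, EReal.top_add_coe]
  · have hF : F ≠ ∞ := by
      refine ne_top_of_le_ne_top (ENNReal.add_ne_top.2 ⟨hP, hneg⟩) ?_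
      rw [hsum]
      exact le_self_add
    lift P to NNReal using hP
    lift F to NNReal using hF
    lift N to NNReal using hN
    lift B to NNReal using hpos
    lift B' to NNReal using hneg
    have hs : (P : ℝ) + B' = F + (B + N) := by exact_mod_cast hsum
    rw [EReal.coe_nnreal_eq_coe_real, EReal.coe_nnreal_eq_coe_real,
      EReal.coe_nnreal_eq_coe_real, ENNReal.coe_toReal, ENNReal.coe_toReal]
    rw [← EReal.coe_sub, ← EReal.coe_add, EReal.coe_eq_coe_iff]
    linarith

variable {T X : Type*} [MeasurableSpace T] [NormedAddCommGroup X] [NormedSpace ℝ X]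
  [MeasurableSpace X] [BorelSpace X] [TopologicalSpace.SeparableSpace X]
  [CompleteSpace X]

/-- Approximate Fréchet subgradients of a nonnegative integrand on a `σ`-finite measure space. -/
theorem exists_seq_isFrechetSubgradient_sigmaFinite (μ : Measure T) [SigmaFinite μ]
    (L : Submodule ℝ X) [FiniteDimensional ℝ L] (x : X) {J : X → StrongDual ℝ X}
    (hJ : ∀ v, HasFDerivAt (fun u : X => ‖u‖ ^ 2) (J v) v)
    (hJc : Continuous J) (hJb : ∀ v, ‖J v‖ ≤ 2 * ‖v‖)
    {F : T → X → ℝ≥0∞} (hF : Measurable (Function.uncurry F))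
    (hFl : ∀ t, LowerSemicontinuous (F t)) (hFx : ∫⁻ t, F t x ∂μ ≠ ∞) (x' : StrongDual ℝ X)
    {r ε : ℝ} (hr : 0 < r) (hr₁ : r ≤ 1) (hε : 0 < ε)
    (hmin : ∀ e : L, ‖e‖ ≤ r →
      ENNReal.ofReal ((∫⁻ t, F t x ∂μ).toReal + x' e - ε * ‖e‖) ≤ ∫⁻ t, F t (x + e) ∂μ) :
    ∃ (u : ℕ → T → X) (e : ℕ → L) (ξ : ℕ → T → StrongDual ℝ X),
      (∀ n, Measurable (u n)) ∧ (∀ n t, ‖u n t - x‖ ≤ 1) ∧ (∀ n, Integrable (ξ n) μ) ∧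
      (∀ᶠ n in atTop, ∀ᵐ t ∂μ, IsFrechetSubgradient (F t) (u n t) (ξ n t)) ∧
      Tendsto e atTop (𝓝 0) ∧
      (∃ c : ℕ → ℝ, Tendsto c atTop (𝓝 0) ∧ ∀ n, ∀ᵐ t ∂μ, ‖u n t - x‖ ≤ c n) ∧
      Tendsto (fun n => ∫ t, ‖ξ n t‖ * ‖u n t - (x + e n)‖ ∂μ) atTop (𝓝 0) ∧
      Tendsto (fun n => ∫⁻ t, ((F t (u n t) - F t x) + (F t x - F t (u n t))) ∂μ) atTop (𝓝 0) ∧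
      (∀ᶠ n in atTop, ∀ d : L, |(∫ t, ξ n t ∂μ) d - x' d| ≤ 3 * ε * ‖d‖) := by
  obtain ⟨h, hpos, hhm, hh⟩ := exists_pos_lintegral_lt_of_sigmaFinite μ one_ne_zero
  have hFm : ∀ {v : T → X}, Measurable v → Measurable fun t => F t (v t) := fun hv =>
    hF.comp (measurable_id.prodMk hv)
  have hFxm : Measurable fun t => F t x := hFm measurable_const
  -- The summand `F t x` normalizes the integrand to at most `1` at `x`; the positive integrable `h`
  -- keeps the density nonzero, so null sets are unchanged.
  let α : T → NNReal := fun t => (F t x).toNNReal + h t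
  have hαm : Measurable α := hFxm.ennreal_toNNReal.add hhm
  have hα : ∀ t, α t ≠ 0 := fun t => (add_pos_of_nonneg_of_pos zero_le (hpos t)).ne'
  have hαt : ∀ t, (α t : ℝ≥0∞) ≠ 0 := fun t => by exact_mod_cast hα t
  have hαint : ∫⁻ t, α t ∂μ ≠ ∞ := by
    have hle : ∫⁻ t, α t ∂μ ≤ ∫⁻ t, F t x ∂μ + ∫⁻ t, h t ∂μ := by
      rw [← lintegral_add_left hFxm]
      refine lintegral_mono fun t => ?_
      rw [ENNReal.coe_add]
      exact add_le_add ENNReal.coe_toNNReal_le_self le_rfl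
    exact ne_top_of_le_ne_top (ENNReal.add_ne_top.2 ⟨hFx, (hh.trans ENNReal.one_lt_top).ne⟩) hle
  let ν : Measure T := μ.withDensity fun t => α t
  have hν : IsFiniteMeasure ν := isFiniteMeasure_withDensity hαint
  have hac : μ ≪ ν := withDensity_absolutelyContinuous' hαm.coe_nnreal_ennreal.aemeasurable
    (ae_of_all _ hαt)
  let G : T → X → ℝ≥0∞ := fun t v => (α t : ℝ≥0∞)⁻¹ * F t v
  have hGF : ∀ t v, (α t : ℝ≥0∞) * G t v = F t v := fun t v => by
    rw [← mul_assoc, ENNReal.mul_inv_cancel (hαt t) ENNReal.coe_ne_top, one_mul]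
  have hGm : Measurable (Function.uncurry G) :=
    (hαm.coe_nnreal_ennreal.inv.comp measurable_fst).mul hF
  have hGl : ∀ t, LowerSemicontinuous (G t) := fun t =>
    (ENNReal.continuous_const_mul (ENNReal.inv_ne_top.2 (hαt t))).comp_lowerSemicontinuous
      (hFl t) fun a b hab => mul_le_mul_right hab _
  have hGx : ∀ᵐ t ∂ν, G t x ≤ 1 := by
    refine (withDensity_absolutelyContinuous μ _).ae_le ?_
    filter_upwards [ae_lt_top hFxm hFx] with t ht
    calc G t x ≤ (α t : ℝ≥0∞)⁻¹ * α t := by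
          refine mul_le_mul_right ?_ _
          rw [ENNReal.coe_add, ENNReal.coe_toNNReal ht.ne]
          exact le_self_add
      _ = 1 := ENNReal.inv_mul_cancel (hαt t) ENNReal.coe_ne_top
  have hlint : ∀ ψ : T → ℝ≥0∞, ∫⁻ t, ψ t ∂ν = ∫⁻ t, α t * ψ t ∂μ := fun ψ =>
    lintegral_withDensity_eq_lintegral_mul_non_measurable _ hαm.coe_nnreal_ennreal
      (ae_of_all _ fun t => ENNReal.coe_lt_top) ψ
  have hGint : ∀ v : X, ∫⁻ t, G t v ∂ν = ∫⁻ t, F t v ∂μ := fun v => by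
    rw [hlint]
    simp_rw [hGF]
  obtain ⟨u, e, ξ, hu, hub, hξm, hξb, hξs, he, ⟨c, hc, huc⟩, hcl, hFlim, hfoc⟩ :=
    exists_seq_isFrechetSubgradient ν L x hJ hJc hJb hGm hGl hGx x' hr hr₁ hε
      (fun e he => by rw [hGint, hGint]; exact hmin e he)
  refine ⟨u, e, fun n t => α t • ξ n t, hu, hub, fun n => ?_, ?_, he,
    ⟨c, hc, fun n => hac.ae_le (huc n)⟩, ?_, ?_, ?_⟩
  · obtain ⟨C, hC⟩ := hξb n
    have : Integrable (ξ n) ν := Integrable.of_bound (hξm n) C (ae_of_all _ hC)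
    exact (integrable_withDensity_iff_integrable_smul hαm).1 this
  · filter_upwards [hξs] with n hn
    filter_upwards [hac.ae_le hn] with t ht
    have := ht.const_mul (hα t)
    simp_rw [hGF] at this
    exact this
  · refine hcl.congr fun n => ?_
    rw [integral_withDensity_eq_integral_smul hαm]
    refine integral_congr_ae (ae_of_all _ fun t => ?_)
    simp only [NNReal.smul_def, norm_smul, smul_eq_mul, mul_assoc]
    rw [Real.norm_of_nonneg (α t).coe_nonneg]
  · refine hFlim.congr fun n => ?_
    rw [hlint]
    refine lintegral_congr fun t => ?_
    rw [mul_add, ENNReal.mul_sub fun _ _ => ENNReal.coe_ne_top,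
      ENNReal.mul_sub fun _ _ => ENNReal.coe_ne_top, hGF, hGF]
  · filter_upwards [hfoc] with n hn d
    have := hn d
    rwa [integral_withDensity_eq_integral_smul hαm] at this

end Reduction

/-! ### The integral of the smooth minorant. -/

section SmoothIntegrand

theorem integrable_of_lipschitz_bound {T X : Type*} [MeasurableSpace T] {μ : Measure T}
    [NormedAddCommGroup X] [MeasurableSpace X] {g : T → X → ℝ} (hg : Measurable (Function.uncurry g))
    {k : T → ℝ} (hk : Integrable k μ) (hlip : ∀ᵐ t ∂μ, ∀ u v, ‖g t u - g t v‖ ≤ k t * ‖u - v‖)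
    {u₀ : X} (hu₀ : Integrable (fun t => g t u₀) μ) (v : X) : Integrable (fun t => g t v) μ := by
  have hm : Measurable fun t => g t v := hg.comp (measurable_id.prodMk measurable_const)
  refine Integrable.mono' ((hk.mul_const ‖v - u₀‖).add hu₀.norm) hm.aestronglyMeasurable ?_
  filter_upwards [hlip] with t ht
  have h1 := norm_le_norm_sub_add (g t v) (g t u₀)
  exact h1.trans (add_le_add (ht v u₀) le_rfl)

variable {T X : Type*} [MeasurableSpace T] {μ : Measure T} [NormedAddCommGroup X] [NormedSpace ℝ X]
  [MeasurableSpace X] [BorelSpace X] [TopologicalSpace.SeparableSpace X]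
  [TopologicalSpace.SeparableSpace (StrongDual ℝ X)]

theorem exists_integrable_fderiv_bound {g : T → X → ℝ} (hg : Measurable (Function.uncurry g))
    (hgd : ∀ t, ContDiff ℝ 1 (g t)) (hgrad : ∫⁻ t, ⨆ u : X, ‖fderiv ℝ (g t) u‖ₑ ∂μ < ∞) :
    ∃ k : T → ℝ, Measurable k ∧ Integrable k μ ∧ (∀ t, 0 ≤ k t) ∧
      ∀ᵐ t ∂μ, (∀ u, ‖fderiv ℝ (g t) u‖ ≤ k t) ∧ ∀ u v, ‖g t u - g t v‖ ≤ k t * ‖u - v‖ := by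
  have hm := measurable_iSup_enorm_fderiv hg hgd
  refine ⟨fun t => (⨆ u : X, ‖fderiv ℝ (g t) u‖ₑ).toReal, hm.ennreal_toReal,
    integrable_toReal_of_lintegral_ne_top hm.aemeasurable hgrad.ne,
    fun t => ENNReal.toReal_nonneg, ?_⟩
  filter_upwards [ae_lt_top hm hgrad.ne] with t ht
  have hb : ∀ u, ‖fderiv ℝ (g t) u‖ ≤ (⨆ u : X, ‖fderiv ℝ (g t) u‖ₑ).toReal := fun u => by
    rw [← toReal_enorm]
    exact ENNReal.toReal_mono ht.ne (le_iSup (fun u => ‖fderiv ℝ (g t) u‖ₑ) u)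
  refine ⟨hb, fun u v => ?_⟩
  exact convex_univ.norm_image_sub_le_of_norm_fderiv_le
    (fun y _ => (hgd t).differentiable one_ne_zero y) (fun y _ => hb y) (Set.mem_univ v)
    (Set.mem_univ u)

theorem hasFDerivAt_integral_of_fderiv_bound {g : T → X → ℝ}
    (hg : Measurable (Function.uncurry g)) (hgd : ∀ t, Differentiable ℝ (g t))
    {k : T → ℝ} (hk : Integrable k μ) (hb : ∀ᵐ t ∂μ, ∀ u, ‖fderiv ℝ (g t) u‖ ≤ k t)
    (hgi : ∀ v, Integrable (fun t => g t v) μ) (x : X) :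
    HasFDerivAt (fun v => ∫ t, g t v ∂μ) (∫ t, fderiv ℝ (g t) x ∂μ) x := by
  refine hasFDerivAt_integral_of_dominated_of_fderiv_le (F := fun v t => g t v)
    (F' := fun v t => fderiv ℝ (g t) v) (bound := k) univ_mem
    (Eventually.of_forall fun v => (hgi v).aestronglyMeasurable) (hgi x)
    (stronglyMeasurable_fderiv_comp hg hgd measurable_const).aestronglyMeasurable
    ?_ hk (ae_of_all _ fun t v _ => (hgd t v).hasFDerivAt)
  filter_upwards [hb] with t ht v _
  exact ht v

/-- Dominated convergence for the gradients of a smooth integrand. -/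
theorem tendsto_integral_fderiv {g : T → X → ℝ}
    (hg : Measurable (Function.uncurry g)) (hgd : ∀ t, ContDiff ℝ 1 (g t))
    {k : T → ℝ} (hk : Integrable k μ) (hb : ∀ᵐ t ∂μ, ∀ u, ‖fderiv ℝ (g t) u‖ ≤ k t)
    {u : ℕ → T → X} (hu : ∀ n, Measurable (u n)) {x : X}
    (hux : ∀ᵐ t ∂μ, Tendsto (fun n => u n t) atTop (𝓝 x)) :
    Tendsto (fun n => ∫ t, fderiv ℝ (g t) (u n t) ∂μ) atTop (𝓝 (∫ t, fderiv ℝ (g t) x ∂μ)) := by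
  refine tendsto_integral_of_dominated_convergence k
    (fun n => (stronglyMeasurable_fderiv_comp hg
      (fun t => (hgd t).differentiable one_ne_zero) (hu n)).aestronglyMeasurable) hk
    (fun n => ?_) ?_
  · filter_upwards [hb] with t ht
    exact ht _
  · filter_upwards [hux] with t ht
    exact (((hgd t).continuous_fderiv one_ne_zero).tendsto x).comp ht

end SmoothIntegrand

/-! ### Assembly. -/

section MainTheorem

variable {T X : Type*} [MeasurableSpace T] [NormedAddCommGroup X]

theorem IsNormalIntegrand.measurable_toENNReal_sub [MeasurableSpace X] [BorelSpace X]
    {f : T → X → EReal} {g : T → X → ℝ}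
    (hf : IsNormalIntegrand f) (hg : Measurable (Function.uncurry g)) :
    Measurable (Function.uncurry fun t v => (f t v - (g t v : EReal)).toENNReal) := by
  have h : Measurable fun q : T × X => (-(g q.1 q.2) : ℝ) := Measurable.neg hg
  have h' : Measurable fun q : T × X => f q.1 q.2 + ((-(g q.1 q.2) : ℝ) : EReal) :=
    hf.measurable.add h.coe_real_ereal
  refine Measurable.ereal_toENNReal ?_
  simpa only [sub_eq_add_neg, EReal.coe_neg] using h'

theorem IsNormalIntegrand.lowerSemicontinuous_toENNReal_sub [MeasurableSpace X] [BorelSpace X]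
    {f : T → X → EReal} {g : T → X → ℝ}
    (hf : IsNormalIntegrand f) (hg : ∀ t, Continuous (g t)) (t : T) :
    LowerSemicontinuous fun v => (f t v - (g t v : EReal)).toENNReal := by
  have h : LowerSemicontinuous fun v => f t v + ((-(g t v) : ℝ) : EReal) := by
    refine (hf.lowerSemicontinuous t).add'
      (continuous_coe_real_ereal.comp (hg t).neg).lowerSemicontinuous fun v => ?_
    exact EReal.continuousAt_add (Or.inr (EReal.coe_ne_bot _)) (Or.inr (EReal.coe_ne_top _))
  have h' := EReal.continuous_toENNReal.comp_lowerSemicontinuous h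
    fun _ _ => EReal.toENNReal_le_toENNReal
  simpa only [sub_eq_add_neg, EReal.coe_neg, Function.comp_def] using h'

variable [NormedSpace ℝ X]

/-- Passing from the Fréchet subdifferential of `I_f` to a one-sided estimate for the nonnegative
part `f - g`. -/
theorem exists_radius_le_lintegral {Φ : X → EReal} {P : X → ℝ≥0∞} {I : X → ℝ}
    (hΦ : ∀ v, Φ v = (P v : EReal) + (I v : EReal)) {x : X} {x' p : StrongDual ℝ X}
    (hx' : x' ∈ frechetSubdifferential Φ x) (hI : HasFDerivAt I p x) {ε : ℝ} (hε : 0 < ε) :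
    P x ≠ ∞ ∧ ∃ r > 0, ∀ w, ‖w - x‖ ≤ r →
      ENNReal.ofReal ((P x).toReal + (x' - p) (w - x) - ε * ‖w - x‖) ≤ P w := by
  obtain ⟨htop, -, h⟩ := mem_frechetSubdifferential_iff.1 hx'
  have hP : P x ≠ ∞ := by
    intro hP
    rw [hΦ, hP] at htop
    simp at htop
  have hreal : ∀ v, P v ≠ ∞ → Φ v = (((P v).toReal + I v : ℝ) : EReal) := fun v hv => by
    rw [hΦ, EReal.coe_add, EReal.coe_ennreal_toReal hv]
  refine ⟨hP, ?_⟩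
  have hev : ∀ᶠ w in 𝓝 x,
      ENNReal.ofReal ((P x).toReal + (x' - p) (w - x) - ε * ‖w - x‖) ≤ P w := by
    filter_upwards [h (ε / 2) (half_pos hε), hI.isLittleO.def (half_pos hε)] with w hw hIw
    by_cases hPw : P w = ∞
    · simp [hPw]
    rw [hreal w hPw, hreal x hP, EReal.toReal_coe, EReal.coe_le_coe_iff] at hw
    refine ENNReal.ofReal_le_of_le_toReal ?_
    have h2 := (abs_le.1 (Real.norm_eq_abs _ ▸ hIw)).2
    rw [sub_apply]
    linarith
  obtain ⟨r, hr, hball⟩ := Metric.eventually_nhds_iff_ball.1 hev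
  refine ⟨r / 2, half_pos hr, fun w hw => hball w ?_⟩
  rw [mem_ball_iff_norm]
  linarith

variable {μ : Measure T} [SigmaFinite μ] [CompleteSpace X] [MeasurableSpace X] [BorelSpace X]
  [TopologicalSpace.SeparableSpace X] [TopologicalSpace.SeparableSpace (StrongDual ℝ X)]

/-- The theorem at a single accuracy `η`: every required quantity is eventually small along one
sequence, so a common index can be taken. -/
theorem exists_approximate_subgradient
    (hnorm : ContDiffOn ℝ 1 (fun u : X => ‖u‖) {0}ᶜ)
    {f : T → X → EReal} {g : T → X → ℝ} (hf : IsNormalIntegrand f)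
    (hgm : Measurable (Function.uncurry g))
    (hgf : ∀ t u, ((g t u : ℝ) : EReal) ≤ f t u)
    (hgC1 : ∀ t, ContDiff ℝ 1 (g t))
    (hgint : ∃ u₀ : X, Integrable (fun t => g t u₀) μ)
    (hgrad : ∫⁻ t, ⨆ u : X, ‖fderiv ℝ (g t) u‖ₑ ∂μ < ∞)
    {x : X} {x' : StrongDual ℝ X}
    (hx' : x' ∈ frechetSubdifferential (integralFunctional μ f) x)
    (ρ : Seminorm ℝ (WeakDual ℝ X)) (hρ : Continuous ρ) {η : ℝ} (hη : 0 < η) :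
    ∃ (y : X) (xs : T → X) (xs' : T → StrongDual ℝ X),
      MemLp xs ∞ μ ∧ MemLp xs' 1 μ ∧
      (∀ᵐ t ∂μ, xs' t ∈ frechetSubdifferential (f t) (xs t)) ∧
      ‖x - y‖ ≤ η ∧ eLpNorm (fun t => x - xs t) ∞ μ ≤ ENNReal.ofReal η ∧
      ∫ t, ‖xs' t‖ * ‖xs t - y‖ ∂μ ≤ η ∧ |∫ t, xs' t (xs t - x) ∂μ| ≤ η ∧
      ρ (StrongDual.toWeakDual ((∫ t, xs' t ∂μ) - x')) ≤ η ∧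
      ∫⁻ t, (f t (xs t) - f t x).abs ∂μ ≤ ENNReal.ofReal η := by
  have : SecondCountableTopology X := UniformSpace.secondCountable_of_separable X
  obtain ⟨J, hJ, hJc, hJb⟩ := exists_hasFDerivAt_norm_sq hnorm
  obtain ⟨L, C, hL, hC, hρL⟩ := ρ.exists_finiteDimensional_bound hρ
  obtain ⟨k, hkm, hk, hk₀, hkae⟩ := exists_integrable_fderiv_bound hgm hgC1 hgrad
  obtain ⟨u₀, hu₀⟩ := hgint
  have hgd : ∀ t, Differentiable ℝ (g t) := fun t => (hgC1 t).differentiable one_ne_zero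
  have hkb : ∀ᵐ t ∂μ, ∀ u, ‖fderiv ℝ (g t) u‖ ≤ k t := hkae.mono fun t ht => ht.1
  have hklip : ∀ᵐ t ∂μ, ∀ u v, ‖g t u - g t v‖ ≤ k t * ‖u - v‖ := hkae.mono fun t ht => ht.2
  have hgi := integrable_of_lipschitz_bound hgm hk hklip hu₀
  set p : StrongDual ℝ X := ∫ t, fderiv ℝ (g t) x ∂μ with hp
  have hIg := hasFDerivAt_integral_of_fderiv_bound hgm hgd hk hkb hgi x
  let F : T → X → ℝ≥0∞ := fun t v => (f t v - (g t v : EReal)).toENNReal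
  have hFm : Measurable (Function.uncurry F) := hf.measurable_toENNReal_sub hgm
  have hFl : ∀ t, LowerSemicontinuous (F t) :=
    hf.lowerSemicontinuous_toENNReal_sub fun t => (hgC1 t).continuous
  have hfF : ∀ t v, f t v = (F t v : EReal) + (g t v : EReal) := fun t v =>
    (coe_toENNReal_sub_add (hgf t v)).symm
  have hI : ∀ v, integralFunctional μ f v =
      ((∫⁻ t, F t v ∂μ : ℝ≥0∞) : EReal) + ((∫ t, g t v ∂μ : ℝ) : EReal) := fun v =>
    extendedIntegral_eq_add (hf.measurable.comp (measurable_id.prodMk measurable_const))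
      (hgm.comp (measurable_id.prodMk measurable_const)) (hgi v) fun t => hgf t v
  -- The error on `L` will be `4 * ε`: three from the nonnegative part and one from the convergence
  -- of the integrated gradients. The seminorm multiplies it by `C`.
  let ε : ℝ := η / (4 * (C + 1))
  have hε : 0 < ε := by positivity
  obtain ⟨hFx, r, hr, hmin⟩ := exists_radius_le_lintegral hI hx' hIg hε
  obtain ⟨u, e, ζ, hu, hub, hζ, hζs, he, ⟨c, hc, huc⟩, hcl, hFlim, hfoc⟩ :=
    exists_seq_isFrechetSubgradient_sigmaFinite μ L x hJ hJc hJb hFm hFl hFx (x' - p)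
      (lt_min hr one_pos) (min_le_right _ _) hε fun d hd => by
        simpa using hmin (x + d) (by simpa using hd.trans (min_le_left _ _))
  obtain ⟨D, hD⟩ : ∃ D : ℕ → T → StrongDual ℝ X, D = fun n t => fderiv ℝ (g t) (u n t) :=
    ⟨_, rfl⟩
  have hDb : ∀ n, ∀ᵐ t ∂μ, ‖D n t‖ ≤ k t := fun n => by
    simpa only [hD] using hkb.mono fun t ht => ht (u n t)
  have hDi : ∀ n, Integrable (D n) μ := fun n => by
    refine Integrable.mono' hk ?_ (hDb n)
    rw [hD]
    exact (stronglyMeasurable_fderiv_comp hgm hgd (hu n)).aestronglyMeasurable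
  have hux : ∀ᵐ t ∂μ, Tendsto (fun n => u n t) atTop (𝓝 x) := by
    filter_upwards [ae_all_iff.2 huc] with t ht
    rw [tendsto_iff_norm_sub_tendsto_zero]
    exact squeeze_zero (fun n => norm_nonneg _) ht hc
  have hDlim : Tendsto (fun n => ∫ t, D n t ∂μ) atTop (𝓝 p) := by
    rw [hD]
    exact tendsto_integral_fderiv hgm hgC1 hk hkb hu hux
  let z : ℕ → T → StrongDual ℝ X := fun n t => ζ n t + D n t
  have hz : ∀ n, Integrable (z n) μ := fun n =>
    Integrable.fun_add (f := ζ n) (g := D n) (hζ n) (hDi n)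
  have he₀ : Tendsto (fun n => ‖e n‖) atTop (𝓝 0) := by simpa using he.norm
  have huw : ∀ n t, ‖u n t - (x + e n)‖ ≤ 1 + ‖e n‖ := by
    intro n t
    have h1 := norm_sub_le (u n t - x) (e n : X)
    rw [sub_sub] at h1
    exact h1.trans (add_le_add (hub n t) le_rfl)
  have hprod : ∀ {ξ : T → StrongDual ℝ X}, Integrable ξ μ → ∀ n,
      Integrable (fun t => ‖ξ t‖ * ‖u n t - (x + e n)‖) μ := by
    intro ξ hξ n
    refine Integrable.mul_bdd (c := 1 + ‖e n‖) hξ.norm ((hu n).sub_const _).norm.aestronglyMeasurable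
      (ae_of_all _ fun t => ?_)
    rw [norm_norm]
    exact huw n t
  have hclose : Tendsto (fun n => ∫ t, ‖z n t‖ * ‖u n t - (x + e n)‖ ∂μ) atTop (𝓝 0) := by
    have hlim : Tendsto (fun n => ∫ t, ‖ζ n t‖ * ‖u n t - (x + e n)‖ ∂μ +
        (∫ t, k t ∂μ) * (c n + ‖e n‖)) atTop (𝓝 0) := by
      simpa using hcl.add ((hc.add he₀).const_mul (∫ t, k t ∂μ))
    refine squeeze_zero (fun n => integral_nonneg fun t => by positivity) (fun n => ?_) hlim
    rw [← integral_mul_const, ← integral_add (hprod (hζ n) n) (hk.mul_const _)]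
    refine integral_mono_ae (hprod (hz n) n) ((hprod (hζ n) n).add (hk.mul_const _)) ?_
    filter_upwards [hDb n, huc n] with t h1 h2
    have h3 : ‖u n t - (x + e n)‖ ≤ c n + ‖e n‖ := by
      have h := norm_sub_le (u n t - x) (e n : X)
      rw [sub_sub] at h
      exact h.trans (add_le_add h2 le_rfl)
    calc ‖z n t‖ * ‖u n t - (x + e n)‖
        ≤ (‖ζ n t‖ + ‖D n t‖) * ‖u n t - (x + e n)‖ := by
          gcongr
          exact norm_add_le _ _
      _ = ‖ζ n t‖ * ‖u n t - (x + e n)‖ + ‖D n t‖ * ‖u n t - (x + e n)‖ := add_mul _ _ _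
      _ ≤ _ := add_le_add le_rfl (mul_le_mul h1 h3 (norm_nonneg _) (hk₀ t))
  have hfoc' : ∀ᶠ n in atTop, ∀ d : L, |((∫ t, z n t ∂μ) - x') d| ≤ 4 * ε * ‖d‖ := by
    have hDn : Tendsto (fun n => ‖(∫ t, D n t ∂μ) - p‖) atTop (𝓝 0) :=
      tendsto_iff_norm_sub_tendsto_zero.1 hDlim
    filter_upwards [hfoc, hDn.eventually_le_const hε] with n h1 h2 d
    have h3 : ((∫ t, z n t ∂μ) - x') d =
        ((∫ t, ζ n t ∂μ) d - (x' - p) d) + ((∫ t, D n t ∂μ) - p) d := by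
      simp only [z]
      rw [integral_add (hζ n) (hDi n)]
      simp only [sub_apply, add_apply]
      ring
    have h4 : |((∫ t, D n t ∂μ) - p) d| ≤ ε * ‖d‖ :=
      (ContinuousLinearMap.le_opNorm _ _).trans (mul_le_mul_of_nonneg_right h2 (norm_nonneg _))
    rw [h3]
    refine (abs_add_le _ _).trans ((add_le_add (h1 d) h4).trans_eq ?_)
    ring
  have hpair : ∀ᶠ n in atTop, |∫ t, z n t (u n t - x) ∂μ| ≤
      ∫ t, ‖z n t‖ * ‖u n t - (x + e n)‖ ∂μ + (4 * ε + ‖x'‖) * ‖e n‖ := by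
    filter_upwards [hfoc'] with n hn
    have hi : Integrable (fun t => z n t (u n t - (x + e n))) μ := by
      refine Integrable.mono' (hprod (hz n) n) ?_ (ae_of_all _ fun t => (z n t).le_opNorm _)
      have hm : AEStronglyMeasurable (fun t => u n t - (x + e n)) μ :=
        ((hu n).sub_const _).aestronglyMeasurable
      exact (ContinuousLinearMap.id ℝ (StrongDual ℝ X)).aestronglyMeasurable_comp₂
        (hz n).aestronglyMeasurable hm
    -- Since `e n` does not depend on `t`, its contribution is the integrated functional at `e n`,
    -- which is bounded on `L` by the previous estimate.
    have h1 : ∫ t, z n t (u n t - x) ∂μ =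
        ∫ t, z n t (u n t - (x + e n)) ∂μ + (∫ t, z n t ∂μ) (e n) := by
      rw [ContinuousLinearMap.integral_apply (hz n),
        ← integral_add hi ((hz n).apply_continuousLinearMap _)]
      refine integral_congr_ae (ae_of_all _ fun t => ?_)
      simp only
      rw [← map_add]
      congr 1
      abel
    have h2 : |∫ t, z n t (u n t - (x + e n)) ∂μ| ≤ ∫ t, ‖z n t‖ * ‖u n t - (x + e n)‖ ∂μ :=
      norm_integral_le_of_norm_le (hprod (hz n) n) (ae_of_all _ fun t => (z n t).le_opNorm _)
    have h3 : |(∫ t, z n t ∂μ) (e n)| ≤ (4 * ε + ‖x'‖) * ‖e n‖ := by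
      have h4 := hn (e n)
      have h5 : |x' (e n)| ≤ ‖x'‖ * ‖e n‖ := x'.le_opNorm _
      rw [sub_apply] at h4
      have h6 := abs_add_le ((∫ t, z n t ∂μ) (e n) - x' (e n)) (x' (e n))
      rw [sub_add_cancel] at h6
      linarith
    rw [h1]
    exact (abs_add_le _ _).trans (add_le_add h2 h3)
  have hpair₀ : Tendsto (fun n => ∫ t, ‖z n t‖ * ‖u n t - (x + e n)‖ ∂μ +
      (4 * ε + ‖x'‖) * ‖e n‖) atTop (𝓝 0) := by
    simpa using hclose.add (he₀.const_mul (4 * ε + ‖x'‖))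
  have hflim : Tendsto (fun n => ∫⁻ t, ((F t (u n t) - F t x) + (F t x - F t (u n t))) ∂μ +
      ENNReal.ofReal ((∫ t, k t ∂μ) * c n)) atTop (𝓝 0) := by
    have h1 := ENNReal.tendsto_ofReal (hc.const_mul (∫ t, k t ∂μ))
    rw [mul_zero, ENNReal.ofReal_zero] at h1
    simpa using hFlim.add h1
  have hFm' : ∀ {v : T → X}, Measurable v → Measurable fun t => F t (v t) := fun hv =>
    hFm.comp (measurable_id.prodMk hv)
  have hfle : ∀ᶠ n in atTop, ∫⁻ t, (f t (u n t) - f t x).abs ∂μ ≤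
      ∫⁻ t, ((F t (u n t) - F t x) + (F t x - F t (u n t))) ∂μ +
        ENNReal.ofReal ((∫ t, k t ∂μ) * c n) := by
    filter_upwards [hζs] with n hn
    have hFn := hFm' (hu n)
    have hFxm : Measurable fun t => F t x := hFm' measurable_const
    have hsum : Measurable fun t => (F t (u n t) - F t x) + (F t x - F t (u n t)) :=
      (hFn.sub hFxm).add (hFxm.sub hFn)
    -- For `μ = 0` the sign of `c n` is unknown; otherwise it is read off at one point of the
    -- full-measure set.
    rcases eq_or_ne μ 0 with rfl | hμ
    · simp
    have : NeBot (ae μ) := ae_neBot.2 hμ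
    have hcn : 0 ≤ c n := by
      obtain ⟨t, ht⟩ := (huc n).exists
      exact (norm_nonneg _).trans ht
    rw [← integral_mul_const, ofReal_integral_eq_lintegral_ofReal (hk.mul_const _)
      (ae_of_all _ fun t => mul_nonneg (hk₀ t) hcn),
      ← lintegral_add_left hsum]
    refine lintegral_mono_ae ?_
    filter_upwards [hn, ae_lt_top hFxm hFx, hklip, huc n] with t h1 h2 h3 h4
    rw [hfF t (u n t), hfF t x]
    refine (ereal_abs_sub_le_tsub_add_tsub h1.1 h2.ne _ _).trans (add_le_add le_rfl ?_)
    rw [← ofReal_norm]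
    exact ENNReal.ofReal_le_ofReal
      ((h3 _ _).trans (mul_le_mul_of_nonneg_left h4 (hk₀ t)))
  have hηE : (0 : ℝ≥0∞) < ENNReal.ofReal η := ENNReal.ofReal_pos.2 hη
  obtain ⟨n, h1, h2, h3, h4, h5, h6, h7, h8, h9⟩ := (hζs.and <| hfoc'.and <| hpair.and <|
    hfle.and <| (he₀.eventually_le_const hη).and <| (hc.eventually_le_const hη).and <|
    (hclose.eventually_le_const hη).and <| (hpair₀.eventually_le_const hη).and
    (hflim.eventually_le_const hηE)).exists
  refine ⟨x + e n, u n, z n, ?_, memLp_one_iff_integrable.2 (hz n), ?_, ?_, ?_, h7, h3.trans h8,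
    ?_, h4.trans h9⟩
  · refine memLp_top_of_bound (hu n).aestronglyMeasurable (1 + ‖x‖) (ae_of_all _ fun t => ?_)
    have := norm_le_norm_sub_add (u n t) x
    linarith [hub n t]
  · filter_upwards [h1] with t ht
    simp only [z, hD]
    exact ht.add_mem_frechetSubdifferential ((hgd t) _).hasFDerivAt (hfF t)
  · simpa using h5
  · rw [eLpNorm_exponent_top]
    refine eLpNormEssSup_le_of_ae_bound ?_
    filter_upwards [huc n] with t ht
    rw [norm_sub_rev]
    exact ht.trans h6
  · refine (hρL _ (4 * ε) (by positivity) h2).trans ?_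
    have : C * (4 * ε) = η * (C / (C + 1)) := by
      simp only [ε]
      field_simp
    rw [this]
    exact mul_le_of_le_one_right hη.le ((div_le_one (by positivity)).2 (by linarith))

end MainTheorem

theorem mainTheorem2
    {T : Type*} [MeasurableSpace T] (μ : Measure T) [SigmaFinite μ] [μ.IsComplete]
    {X : Type*} [NormedAddCommGroup X] [NormedSpace ℝ X] [CompleteSpace X]
    [MeasurableSpace X] [BorelSpace X]
    [TopologicalSpace.SeparableSpace X] [TopologicalSpace.SeparableSpace (StrongDual ℝ X)]
    (hnorm : ContDiffOn ℝ 1 (fun u : X => ‖u‖) {0}ᶜ)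
    (f : T → X → EReal) (g : T → X → ℝ)
    (hf : IsNormalIntegrand f)
    (hg : IsNormalIntegrand (fun (t : T) (u : X) => ((g t u : ℝ) : EReal)))
    (hgf : ∀ t u, ((g t u : ℝ) : EReal) ≤ f t u)
    (hgC1 : ∀ t, ContDiff ℝ 1 (g t))
    (hgint : ∃ u₀ : X, Integrable (fun t => g t u₀) μ)
    (hgrad : ∫⁻ t, ⨆ u : X, ‖fderiv ℝ (g t) u‖ₑ ∂μ < ∞)
    (x : X) (x' : StrongDual ℝ X)
    (hx' : x' ∈ frechetSubdifferential (integralFunctional μ f) x)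
    (ρ : Seminorm ℝ (WeakDual ℝ X)) (hρ : Continuous ρ) :
    ∃ (y : ℕ → X) (xs : ℕ → T → X) (xs' : ℕ → T → StrongDual ℝ X),
      (∀ n, MemLp (xs n) ∞ μ) ∧
      (∀ n, MemLp (xs' n) 1 μ) ∧
      (∀ n, ∀ᵐ t ∂μ, xs' n t ∈ frechetSubdifferential (f t) (xs n t)) ∧
      Tendsto (fun n => ‖x - y n‖) atTop (𝓝 0) ∧
      Tendsto (fun n => eLpNorm (fun t => x - xs n t) ∞ μ) atTop (𝓝 0) ∧
      Tendsto (fun n => ∫ t, ‖xs' n t‖ * ‖xs n t - y n‖ ∂μ) atTop (𝓝 0) ∧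
      Tendsto (fun n => ∫ t, xs' n t (xs n t - x) ∂μ) atTop (𝓝 0) ∧
      Tendsto (fun n => ρ (StrongDual.toWeakDual ((∫ t, xs' n t ∂μ) - x'))) atTop (𝓝 0) ∧
      Tendsto (fun n => ∫⁻ t, (f t (xs n t) - f t x).abs ∂μ) atTop (𝓝 0) := by
  have hgm : Measurable (Function.uncurry g) := by
    have := hg.measurable.ereal_toReal
    exact this
  choose y xs xs' h1 h2 h3 h4 h5 h6 h7 h8 h9 using fun n : ℕ =>
    exists_approximate_subgradient hnorm hf hgm hgf hgC1 hgint hgrad hx' ρ hρ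
      (η := 1 / ((n : ℝ) + 1)) (by positivity)
  have hη : Tendsto (fun n : ℕ => 1 / ((n : ℝ) + 1)) atTop (𝓝 0) :=
    tendsto_one_div_add_atTop_nhds_zero_nat
  have hηE : Tendsto (fun n : ℕ => ENNReal.ofReal (1 / ((n : ℝ) + 1))) atTop (𝓝 0) := by
    simpa only [ENNReal.ofReal_zero] using ENNReal.tendsto_ofReal hη
  refine ⟨y, xs, xs', h1, h2, h3, squeeze_zero (fun n => norm_nonneg _) h4 hη,
    tendsto_of_tendsto_of_tendsto_of_le_of_le tendsto_const_nhds hηE (fun n => zero_le) h5,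
    squeeze_zero (fun n => integral_nonneg fun t => by positivity) h6 hη,
    squeeze_zero_norm h7 hη, squeeze_zero (fun n => apply_nonneg ρ _) h8 hη,
    tendsto_of_tendsto_of_tendsto_of_le_of_le tendsto_const_nhds hηE (fun n => zero_le) h9⟩
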